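/- A test on a subset of $t$ samples is positive if and only if the subset contains at least one defective sample. A (deterministic) $p$-stage algorithm carries out its tests in $p$ successive stages; the tests of a stage may depend on the outcomes of all tests of earlier stages, but not on outcomes of the same stage. Let $N_p(t,s)$ be the minimal worst-case total number of tests needed to find all defectives among $t$ samples, exactly $s$ of which are defective, using at most $p$ stages, and let $$C_p(s)=\varlimsup_{t\to\infty}\frac{N_p(t,s)}{\log_2 t}.$$ **Theorem 2.** $C_5(3)=3$. Moreover $N_5(t,3)=3\log_2 t\,(1+o(1))$ as $t\to\infty$, and this constant is optimal: $C_p(3)\ge 3$ for every number $p\ge 1$ of stages. -/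

import Mathlib

open Filter Topology Asymptotics

/-- A deterministic group testing algorithm on the samples `Fin t` with at most `p` stages.
Either it stops and announces a set of samples, or it carries out a stage: a finite list of `n`
tests (subsets of samples), fixed before any outcome of this stage is known, after which the
outcome vector in `{0,1}ⁿ` determines how the remaining at most `p` stages proceed. -/
inductive MultistageAlgorithm (t : ℕ) : ℕ → Type
  | answer {p : ℕ} (T : Finset (Fin t)) : MultistageAlgorithm t p
  | stage {p : ℕ} (n : ℕ) (tests : Fin n → Finset (Fin t))
      (next : (Fin n → Bool) → MultistageAlgorithm t p) : MultistageAlgorithm t (p + 1)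

/-- The outcome vector of the given tests if `S` is the set of defectives: a test is positive iff
it contains a defective sample. -/
def outcomeVector {t n : ℕ} (tests : Fin n → Finset (Fin t)) (S : Finset (Fin t)) :
    Fin n → Bool :=
  fun i => decide (tests i ∩ S).Nonempty

namespace MultistageAlgorithm

/-- The set announced by the algorithm if `S` is the set of defectives. -/
def output {t : ℕ} : {p : ℕ} → MultistageAlgorithm t p → Finset (Fin t) → Finset (Fin t)
  | _, answer T, _ => T
  | _, stage _ tests next, S => (next (outcomeVector tests S)).output S

/-- The total number of tests carried out if `S` is the set of defectives. -/
def numTests {t : ℕ} : {p : ℕ} → MultistageAlgorithm t p → Finset (Fin t) → ℕ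
  | _, answer _, _ => 0
  | _, stage n tests next, S => n + (next (outcomeVector tests S)).numTests S

/-- The algorithm finds all defectives whenever there are exactly `s` of them, and uses at most
`n` tests in the worst case. -/
def FindsWithin {t p : ℕ} (A : MultistageAlgorithm t p) (s n : ℕ) : Prop :=
  ∀ S : Finset (Fin t), S.card = s → A.output S = S ∧ A.numTests S ≤ n

/-- With at least one stage, all defectives can be found by testing every sample individually. -/
theorem exists_findsWithin (p t s : ℕ) (hp : 1 ≤ p) :
    ∃ A : MultistageAlgorithm t p, A.FindsWithin s t := by
  obtain ⟨q, rfl⟩ : ∃ q, p = q + 1 := ⟨p - 1, by omega⟩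
  refine ⟨.stage t (fun i => {i}) fun y => .answer (Finset.univ.filter fun i => y i = true), ?_⟩
  intro S _
  refine ⟨?_, by simp [numTests]⟩
  ext i
  simp [output, outcomeVector, Finset.Nonempty]

end MultistageAlgorithm

/-- `N_p(t, s)`: the minimal worst-case total number of tests needed to find all `s` defectives
among `t` samples using at most `p` stages. By `MultistageAlgorithm.exists_findsWithin` the set
below is nonempty for `1 ≤ p`, so the infimum is then a minimum. -/
noncomputable def minTests (p t s : ℕ) : ℕ :=
  sInf {n : ℕ | ∃ A : MultistageAlgorithm t p, A.FindsWithin s n}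

/-- `C_p(s) = limsup_{t → ∞} N_p(t, s) / log₂ t`, as an extended real number. -/
noncomputable def asympConst (p s : ℕ) : EReal :=
  limsup (fun t : ℕ => (((minTests p t s : ℝ) / Real.logb 2 (t : ℝ) : ℝ) : EReal)) atTop

/-! Lower bound: however its tests are staged, an algorithm with at most `n` tests tells apart at
most 2^n sets (`Solvable.card_le`), and the number of triples has order t³.

Upper bound: fix a large R and let t ≤ 2^(4Rr) with r → ∞. The first stage consists of n = 11Rr
tests, about (11/4) log₂ t, read off a random code of words of constant weight. Its outcome y is the
union of the three defective codewords, so what remains is the 3-uniform hypergraph H of triples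
with union y. Heuristically H has at most about 2^(12Rr - n) = 2^(Rr) edges, and four more stages
must find the right one with about Rr tests.

Call the expected number of samples completing a pair to union y its expected codegree. Up to
factors 2^(O(r)), `exists_code` gives for all y: matchings in H have size at most 2^(Rr); matchings
in the link of a vertex have bounded size; actual codegrees do not exceed the larger of 1 and the
expected ones; pairs of expected codegree above 2^(jr) have matchings of size at most 2^((R-j)r), by
Markov's inequality. Matching bounds become small hitting sets (`exists_hittingSet`).

Bounded hitting sets of the links yield a colouring with boundedly many colours and rainbow edges
(`exists_strong_coloring`). Then `Solvable.of_stratified` finds a level j and a colour, searches one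
vertex a among about 2^((R-j)r), a second vertex b in the bounded hitting set of the link of a, and
the third among about 2^(jr) leaves. The two logarithms add up to Rr for every j, so the total is
12Rr + O(r) + O_R(1) = (3 + O(1/R)) log₂ t + O_R(1). -/

/-! ### Staged search on families of candidates -/

/-- Some algorithm with at most `p` stages and at most `n` tests identifies every member of the
family `F` of candidate sets. -/
def Solvable {t : ℕ} (p : ℕ) (F : Set (Finset (Fin t))) (n : ℕ) : Prop :=
  ∃ A : MultistageAlgorithm t p, ∀ S ∈ F, A.output S = S ∧ A.numTests S ≤ n

theorem Solvable.of_subsingleton {t p n : ℕ} {F : Set (Finset (Fin t))} (hF : F.Subsingleton) :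
    Solvable p F n := by
  rcases F.eq_empty_or_nonempty with rfl | ⟨S, hS⟩
  · exact ⟨.answer ∅, by simp⟩
  · exact ⟨.answer S, fun S' hS' => ⟨hF hS hS', Nat.zero_le _⟩⟩

theorem Solvable.mono {t p m n : ℕ} {F G : Set (Finset (Fin t))} (h : Solvable p F m)
    (hG : G ⊆ F) (hmn : m ≤ n) : Solvable p G n := by
  obtain ⟨A, hA⟩ := h
  exact ⟨A, fun S hS => ⟨(hA S (hG hS)).1, (hA S (hG hS)).2.trans hmn⟩⟩

theorem Solvable.stage {t p m n : ℕ} {F : Set (Finset (Fin t))} (tests : Fin m → Finset (Fin t))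
    (h : ∀ y, Solvable p {S ∈ F | outcomeVector tests S = y} n) : Solvable (p + 1) F (m + n) := by
  choose A hA using h
  refine ⟨.stage m tests A, fun S hS => ?_⟩
  have := hA (outcomeVector tests S) S ⟨hS, rfl⟩
  exact ⟨this.1, Nat.add_le_add_left this.2 m⟩

/-- Remaining candidates are described by comparison with a reference set `S₀`; outcomes realised by
no candidate leave nothing to find. -/
theorem Solvable.stage_fintype {t p n : ℕ} {F : Set (Finset (Fin t))} {ι : Type*} [Fintype ι]
    (tests : ι → Finset (Fin t))
    (h : ∀ S₀ ∈ F, Solvable p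
      {S ∈ F | ∀ i, (tests i ∩ S).Nonempty ↔ (tests i ∩ S₀).Nonempty} n) :
    Solvable (p + 1) F (Fintype.card ι + n) := by
  let e := Fintype.equivFin ι
  refine Solvable.stage (fun i => tests (e.symm i)) fun y => ?_
  by_cases hy : ∃ S₀ ∈ F, outcomeVector (fun i => tests (e.symm i)) S₀ = y
  · obtain ⟨S₀, hS₀, rfl⟩ := hy
    refine (h S₀ hS₀).mono ?_ le_rfl
    rintro S ⟨hS, hy⟩
    refine ⟨hS, fun i => ?_⟩
    have := congrFun hy (e i)
    simpa [outcomeVector] using this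
  · refine Solvable.of_subsingleton ?_
    rintro S ⟨hS, hy'⟩
    exact absurd ⟨S, hS, hy'⟩ hy

/-- Label the elements of `A` by distinct `b`-bit strings and test, for each bit, those whose bit is
1. Since a candidate meets `A` in one element only, the outcomes spell its label. -/
theorem Solvable.search {t p b n : ℕ} {F : Set (Finset (Fin t))} (A : Finset (Fin t))
    (hA : A.card ≤ 2 ^ b) (h1 : ∀ S ∈ F, (A ∩ S).card = 1)
    (h : ∀ a ∈ A, Solvable p {S ∈ F | a ∈ S} n) : Solvable (p + 1) F (b + n) := by
  obtain ⟨enc⟩ : Nonempty (A ↪ (Fin b → Bool)) :=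
    Function.Embedding.nonempty_of_card_le (by simpa using hA)
  have := Solvable.stage_fintype (p := p) (n := n) (F := F)
    (fun i : Fin b => Finset.univ.filter fun v => ∃ h : v ∈ A, enc ⟨v, h⟩ i = true) ?_
  · simpa using this
  intro S₀ hS₀
  obtain ⟨a, ha⟩ := Finset.card_eq_one.1 (h1 S₀ hS₀)
  have haA : a ∈ A := (Finset.mem_inter.1 (ha ▸ Finset.mem_singleton_self a)).1
  refine (h a haA).mono ?_ le_rfl
  rintro S ⟨hS, hy⟩
  refine ⟨hS, ?_⟩
  obtain ⟨a', ha'⟩ := Finset.card_eq_one.1 (h1 S hS)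
  have haA' : a' ∈ A ∧ a' ∈ S := Finset.mem_inter.1 (ha' ▸ Finset.mem_singleton_self a')
  have key : ∀ (S' : Finset (Fin t)) (v : Fin t) (hv : A ∩ S' = {v}) (hvA : v ∈ A) (i : Fin b),
      ((Finset.univ.filter fun v => ∃ h : v ∈ A, enc ⟨v, h⟩ i = true) ∩ S').Nonempty ↔
        enc ⟨v, hvA⟩ i = true := by
    intro S' v hv hvA i
    have hvS : v ∈ S' := (Finset.mem_inter.1 (hv ▸ Finset.mem_singleton_self v)).2
    constructor
    · rintro ⟨u, hu⟩
      simp only [Finset.mem_inter, Finset.mem_filter, Finset.mem_univ, true_and] at hu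
      obtain ⟨⟨huA, hui⟩, huS⟩ := hu
      have : u = v := Finset.mem_singleton.1 (hv ▸ Finset.mem_inter.2 ⟨huA, huS⟩)
      subst this
      exact hui
    · intro hi
      exact ⟨v, by simpa [hvS] using ⟨hvA, hi⟩⟩
  have heq : enc ⟨a', haA'.1⟩ = enc ⟨a, haA⟩ := by
    funext i
    have := hy i
    rw [key S a' ha' haA'.1, key S₀ a ha haA] at this
    exact Bool.eq_iff_iff.2 this
  have : a' = a := by simpa using enc.injective heq
  exact this ▸ haA'.2

theorem minTests_le_of_solvable {p t s n : ℕ}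
    (h : Solvable p {S : Finset (Fin t) | S.card = s} n) : minTests p t s ≤ n := by
  obtain ⟨A, hA⟩ := h
  exact Nat.sInf_le ⟨A, hA⟩

/-! ### Information-theoretic lower bound -/

/-- A stage of `m` tests splits the family into at most 2^m classes, each resolved within the
remaining `n - m` tests. -/
theorem Solvable.card_le {t p n : ℕ} (F : Finset (Finset (Fin t)))
    (h : Solvable p (F : Set (Finset (Fin t))) n) : F.card ≤ 2 ^ n := by
  obtain ⟨A, hA⟩ := h
  induction A generalizing F n with
  | answer T =>
    have : F.card ≤ 1 := Finset.card_le_one.2 fun a ha b hb =>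
      (hA a ha).1.symm.trans (hA b hb).1
    exact this.trans Nat.one_le_two_pow
  | stage m tests next ih =>
    rcases F.eq_empty_or_nonempty with rfl | ⟨S, hS⟩
    · simp
    have hm : m ≤ n := le_trans (Nat.le_add_right _ _) (hA S hS).2
    obtain ⟨l, rfl⟩ := Nat.exists_eq_add_of_le hm
    classical
    rw [pow_add]
    have := Finset.card_le_mul_card_image_of_maps_to (s := F) (t := Finset.univ)
      (f := outcomeVector tests) (fun _ _ => Finset.mem_univ _) (2 ^ l) (fun y _ => by
        refine ih y _ fun S hS => ?_
        simp only [Finset.coe_filter, Set.mem_ofPred_eq] at hS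
        obtain ⟨hSF, rfl⟩ := hS
        have := hA S hSF
        exact ⟨this.1, Nat.le_of_add_le_add_left this.2⟩)
    simpa [mul_comm] using this

theorem choose_le_two_pow_minTests {p t s : ℕ} (hp : 1 ≤ p) :
    t.choose s ≤ 2 ^ minTests p t s := by
  have hne : {n : ℕ | ∃ A : MultistageAlgorithm t p, A.FindsWithin s n}.Nonempty :=
    ⟨t, MultistageAlgorithm.exists_findsWithin p t s hp⟩
  obtain ⟨A, hA⟩ := Nat.sInf_mem hne
  have := Solvable.card_le (Finset.univ.powersetCard s)
    ⟨A, fun S hS => hA S (Finset.mem_powersetCard.1 hS).2⟩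
  simpa [minTests] using this

/-! ### Hitting sets and rainbow colourings -/

/-- A graph with an orientation of outdegree at most `d` is `2 d + 1`-colorable. -/
theorem exists_coloring_of_outdegree_le {V : Type*} [Fintype V] [DecidableEq V]
    (N : V → Finset V) (d : ℕ) (hN : ∀ v, (N v).card ≤ d) :
    ∃ χ : V → Fin (2 * d + 1), ∀ u v, u ≠ v → u ∈ N v → χ u ≠ χ v := by
  suffices h : ∀ (n : ℕ) (U : Finset V), U.card = n →
      ∃ χ : V → Fin (2 * d + 1), ∀ u ∈ U, ∀ v ∈ U, u ≠ v → u ∈ N v → χ u ≠ χ v by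
    obtain ⟨χ, hχ⟩ := h _ Finset.univ rfl
    exact ⟨χ, fun u v => hχ u (Finset.mem_univ _) v (Finset.mem_univ _)⟩
  intro n
  induction n with
  | zero =>
    intro U hU
    obtain rfl := Finset.card_eq_zero.1 hU
    exact ⟨fun _ => 0, by simp⟩
  | succ n ih =>
    intro U hU
    have hne : U.Nonempty := Finset.card_pos.1 (by omega)
    -- The average indegree inside `U` is at most `d`, so some vertex has total degree at most 2d:
    -- remove it, colour the rest, and a colour is free for it.
    obtain ⟨v, hvU, hv⟩ : ∃ v ∈ U, (U.filter fun u => v ∈ N u).card ≤ d := by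
      refine Finset.exists_le_of_sum_le (f := fun v => (U.filter fun u => v ∈ N u).card)
        (g := fun _ => d) hne ?_
      have := Finset.sum_card_bipartiteAbove_eq_sum_card_bipartiteBelow
        (s := U) (t := U) (fun u v => v ∈ N u)
      simp only [Finset.bipartiteAbove, Finset.bipartiteBelow] at this
      rw [← this]
      refine Finset.sum_le_sum fun u _ => (Finset.card_le_card ?_).trans (hN u)
      intro x hx
      exact (Finset.mem_filter.1 hx).2
    obtain ⟨χ, hχ⟩ := ih (U.erase v) (by rw [Finset.card_erase_of_mem hvU]; omega)
    obtain ⟨c, hc⟩ : ∃ c, c ∉ (N v ∪ U.filter fun u => v ∈ N u).image χ := by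
      by_contra! h
      have h1 : Finset.univ ⊆ (N v ∪ U.filter fun u => v ∈ N u).image χ := fun c _ => h c
      have h2 := (Finset.card_le_card h1).trans
        (Finset.card_image_le.trans (Finset.card_union_le _ _))
      have := hN v
      simp only [Finset.card_univ, Fintype.card_fin] at h2
      omega
    have hc' : ∀ u ∈ U, (u ∈ N v ∨ v ∈ N u) → χ u ≠ c := by
      intro u hu h heq
      refine hc (Finset.mem_image.2 ⟨u, ?_, heq⟩)
      simpa [hu] using h
    refine ⟨Function.update χ v c, fun a ha b hb hab hN' => ?_⟩
    by_cases hav : a = v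
    · subst hav
      simpa [Function.update_of_ne hab.symm] using (hc' b hb (Or.inr hN')).symm
    · by_cases hbv : b = v
      · subst hbv
        simpa [Function.update_of_ne hab] using hc' a ha (Or.inl hN')
      · rw [Function.update_of_ne hav, Function.update_of_ne hbv]
        exact hχ a (Finset.mem_erase.2 ⟨hav, ha⟩) b (Finset.mem_erase.2 ⟨hbv, hb⟩) hab hN'

/-- A family of nonempty `s`-sets in which every disjoint subfamily has at most `n` members has
a hitting set of size at most `n * s`. -/
theorem exists_hittingSet {V : Type*} [Fintype V] [DecidableEq V] (H : Finset (Finset V))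
    (s n : ℕ) (hs : ∀ e ∈ H, e.card = s) (hs0 : s ≠ 0)
    (hn : ∀ M ⊆ H, (M : Set (Finset V)).PairwiseDisjoint id → M.card ≤ n) :
    ∃ W : Finset V, W.card ≤ n * s ∧ ∀ e ∈ H, ∃ v ∈ e, v ∈ W := by
  classical
  -- The vertex set of a maximum disjoint subfamily meets every member, or the subfamily could be
  -- enlarged.
  obtain ⟨M, hM, hmax⟩ := Finset.exists_max_image
    (H.powerset.filter fun M : Finset (Finset V) => (M : Set (Finset V)).PairwiseDisjoint id) Finset.card
    ⟨∅, by simp⟩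
  simp only [Finset.mem_filter, Finset.mem_powerset] at hM hmax
  refine ⟨M.biUnion id, ?_, fun e he => ?_⟩
  · exact (Finset.card_biUnion_le_card_mul _ _ _ fun e he => (hs e (hM.1 he)).le).trans
      (Nat.mul_le_mul_right _ (hn M hM.1 hM.2))
  · by_contra! h
    have hdisj : ∀ a ∈ M, Disjoint e a := fun a ha => Finset.disjoint_left.2 fun v hve hva =>
      h v hve (Finset.mem_biUnion.2 ⟨a, ha, hva⟩)
    have heM : e ∉ M := fun heM => by
      have := disjoint_self.1 (hdisj e heM)
      have h' := hs e he
      rw [this] at h'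
      exact hs0 (by simpa using h'.symm)
    have := hmax (insert e M) ⟨Finset.insert_subset he hM.1, by
      rw [Finset.coe_insert]
      exact hM.2.insert fun a ha _ => hdisj a ha⟩
    rw [Finset.card_insert_of_notMem heM] at this
    omega

/-- The vertices completing `a`, `b` to an edge of the 3-uniform hypergraph `H`. -/
def leaves {V : Type*} [Fintype V] [DecidableEq V] (H : Finset (Finset V)) (a b : V) : Finset V :=
  Finset.univ.filter fun x => x ≠ a ∧ x ≠ b ∧ ({a, b, x} : Finset V) ∈ H

theorem exists_third {V : Type*} [DecidableEq V] {e : Finset V} (he : e.card = 3) {a b : V} (ha : a ∈ e) (hb : b ∈ e)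
    (hab : a ≠ b) : ∃ x, x ≠ a ∧ x ≠ b ∧ e = {a, b, x} := by
  have h1 : ((e.erase a).erase b).card = 1 := by
    rw [Finset.card_erase_of_mem (Finset.mem_erase.2 ⟨hab.symm, hb⟩),
      Finset.card_erase_of_mem ha, he]
  obtain ⟨x, hx⟩ := Finset.card_eq_one.1 h1
  have hx' : x ∈ (e.erase a).erase b := hx ▸ Finset.mem_singleton_self x
  simp only [Finset.mem_erase] at hx'
  refine ⟨x, hx'.2.1, hx'.1, ?_⟩
  rw [← hx, Finset.insert_erase (Finset.mem_erase.2 ⟨hab.symm, hb⟩), Finset.insert_erase ha]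

section Hypergraph

variable {V : Type*} [Fintype V] [DecidableEq V] {H : Finset (Finset V)}

theorem mem_leaves {a b x : V} :
    x ∈ leaves H a b ↔ x ≠ a ∧ x ≠ b ∧ ({a, b, x} : Finset V) ∈ H := by
  simp [leaves]

/-- If all links of a 3-uniform hypergraph have hitting sets of size at most `κ`, then its
vertices can be colored with boundedly many colors such that every edge is rainbow. -/
theorem exists_strong_coloring (h3 : ∀ e ∈ H, e.card = 3) (Cov : V → Finset V) (κ : ℕ)
    (hκ : ∀ v, (Cov v).card ≤ κ) (hcov : ∀ e ∈ H, ∀ v ∈ e, ∃ u ∈ e, u ≠ v ∧ u ∈ Cov v) :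
    ∃ χ : V → Fin (2 * (κ + κ * κ + κ * κ) + 1), ∀ e ∈ H, Set.InjOn χ e := by
  -- Out-neighbours chosen so that any two vertices of an edge are adjacent. If neither of b, c
  -- covers the other, the third vertex a lies in both `Cov b` and `Cov c`; either b is one of few
  -- leaves of c, a, or c lies in `Cov a` and so in the second iterate of `Cov` at b.
  let N : V → Finset V := fun v => (Cov v ∪
    (Cov v).biUnion fun u => if (leaves H v u).card ≤ κ then leaves H v u else ∅) ∪
    (Cov v).biUnion Cov
  have hN : ∀ v, (N v).card ≤ κ + κ * κ + κ * κ := by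
    intro v
    refine (Finset.card_union_le _ _).trans (add_le_add ((Finset.card_union_le _ _).trans
      (add_le_add (hκ v) ?_)) ?_)
    · refine (Finset.card_biUnion_le_card_mul _ _ κ fun u _ => ?_).trans
        (Nat.mul_le_mul_right _ (hκ v))
      split_ifs with h
      · exact h
      · simp
    · exact (Finset.card_biUnion_le_card_mul _ _ κ fun u _ => hκ u).trans
        (Nat.mul_le_mul_right _ (hκ v))
  -- If c were not in `Cov a`, every leaf of the pair would have to be, which makes too many.
  have heavy : ∀ a c, κ < (leaves H a c).card → c ∈ Cov a := by
    intro a c h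
    by_contra hc
    refine absurd ((Finset.card_le_card ?_).trans (hκ a)) (not_le.2 h)
    intro x hx
    obtain ⟨hxa, hxc, hx⟩ := mem_leaves.1 hx
    obtain ⟨u, hu, hua, huC⟩ := hcov _ hx a (by simp)
    simp only [Finset.mem_insert, Finset.mem_singleton] at hu
    rcases hu with rfl | rfl | rfl
    · exact absurd rfl hua
    · exact absurd huC hc
    · exact huC
  obtain ⟨χ, hχ⟩ := exists_coloring_of_outdegree_le N _ hN
  refine ⟨χ, fun e he b hb c hc hbc => ?_⟩
  by_contra hne
  have hb : b ∈ e := hb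
  have hc : c ∈ e := hc
  obtain ⟨a, hab, hac, rfl⟩ := exists_third (h3 e he) hb hc hne
  have h1 : c ∉ N b := fun h => hχ c b (Ne.symm hne) h hbc.symm
  have h2 : b ∉ N c := fun h => hχ b c hne h hbc
  simp only [N, Finset.mem_union, not_or] at h1 h2
  obtain ⟨⟨h1a, h1b⟩, h1c⟩ := h1
  obtain ⟨⟨h2a, h2b⟩, h2c⟩ := h2
  obtain ⟨u, hu, hub, huC⟩ := hcov _ he b hb
  obtain rfl : u = a := by
    simp only [Finset.mem_insert, Finset.mem_singleton] at hu
    rcases hu with rfl | rfl | rfl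
    · exact absurd rfl hub
    · exact absurd huC h1a
    · rfl
  obtain ⟨u', hu', huc', huC'⟩ := hcov _ he c hc
  obtain rfl : u' = u := by
    simp only [Finset.mem_insert, Finset.mem_singleton] at hu'
    rcases hu' with rfl | rfl | rfl
    · exact absurd huC' h2a
    · exact absurd rfl huc'
    · rfl
  by_cases hcod : (leaves H c u').card ≤ κ
  · refine h2b (Finset.mem_biUnion.2 ⟨u', huC', ?_⟩)
    rw [if_pos hcod, mem_leaves]
    refine ⟨hne, hab.symm, ?_⟩
    have : ({c, u', b} : Finset V) = {b, c, u'} := by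
      ext; simp; tauto
    rwa [this]
  · have hsymm : leaves H u' c = leaves H c u' := by
      ext x
      simp only [mem_leaves, Finset.insert_comm u' c]
      tauto
    exact h1c (Finset.mem_biUnion.2 ⟨u', huC, heavy u' c (by rw [hsymm]; omega)⟩)

end Hypergraph

/-! ### Four-stage search in a stratified hypergraph -/

/-- Four stages identify an edge of a 3-uniform hypergraph whose links have bounded hitting sets
and whose vertices are stratified by sets `W j` of small size. -/
theorem Solvable.of_stratified {t : ℕ} {H : Finset (Finset (Fin t))} (h3 : ∀ e ∈ H, e.card = 3)
    (Cov : Fin t → Finset (Fin t)) (κ : ℕ) (hκ : ∀ v, (Cov v).card ≤ κ)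
    (hcov : ∀ e ∈ H, ∀ v ∈ e, ∃ u ∈ e, u ≠ v ∧ u ∈ Cov v)
    {L : ℕ} (W : Fin L → Finset (Fin t)) (w c : Fin L → ℕ) (B : ℕ)
    (hW : ∀ j, (W j).card ≤ 2 ^ w j) (hc : Monotone c) (hB : ∀ j, w j + c j ≤ B)
    (hlev : ∀ e ∈ H, ∃ j, (∃ v ∈ e, v ∈ W j) ∧
      ∀ a ∈ e, ∀ b ∈ e, a ≠ b → (leaves H a b).card ≤ 2 ^ c j) :
    Solvable 4 (H : Set (Finset (Fin t)))
      ((2 * (κ + κ * κ + κ * κ) + 1) * L + κ + B) := by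
  classical
  obtain ⟨χ, hχ⟩ := exists_strong_coloring h3 Cov κ hκ hcov
  -- Take the largest level whose set meets the edge: the level promised by `hlev` is no larger, so
  -- its codegree bound passes to this one as `c` is monotone.
  have hmax : ∀ e ∈ H, ∃ j, (∃ v ∈ e, v ∈ W j) ∧ ∀ i, (∃ v ∈ e, v ∈ W i) → i ≤ j := by
    intro e he
    obtain ⟨j₀, hj₀, -⟩ := hlev e he
    obtain ⟨j, hj, hj'⟩ := Finset.exists_max_image
      (Finset.univ.filter fun j => ∃ v ∈ e, v ∈ W j) id ⟨j₀, by simpa using hj₀⟩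
    exact ⟨j, by simpa using hj, fun i hi => hj' i (by simpa using hi)⟩
  have hst := Solvable.stage_fintype (p := 3) (F := (H : Set (Finset (Fin t)))) (n := κ + B)
    (fun i : Fin (2 * (κ + κ * κ + κ * κ) + 1) × Fin L =>
      Finset.univ.filter fun v => χ v = i.1 ∧ v ∈ W i.2) ?_
  · simpa [add_assoc] using hst
  intro S₀ hS₀
  obtain ⟨j, ⟨a₀, ha₀, ha₀j⟩, hj⟩ := hmax S₀ hS₀
  set A : Finset (Fin t) := Finset.univ.filter fun v => χ v = χ a₀ ∧ v ∈ W j with hA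
  set F : Set (Finset (Fin t)) := {S ∈ (H : Set (Finset (Fin t))) |
    ∀ i : Fin (2 * (κ + κ * κ + κ * κ) + 1) × Fin L,
      ((Finset.univ.filter fun v => χ v = i.1 ∧ v ∈ W i.2) ∩ S).Nonempty ↔
      ((Finset.univ.filter fun v => χ v = i.1 ∧ v ∈ W i.2) ∩ S₀).Nonempty} with hF
  have hFH : ∀ S ∈ F, S ∈ H := fun S hS => hS.1
  have hle : ∀ S ∈ F, ∀ i, (∃ v ∈ S, v ∈ W i) → i ≤ j := by
    rintro S ⟨-, hS⟩ i ⟨v, hv, hvi⟩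
    obtain ⟨u, hu⟩ := (hS (χ v, i)).1 ⟨v, by simp [hv, hvi]⟩
    simp only [Finset.mem_inter, Finset.mem_filter, Finset.mem_univ, true_and] at hu
    exact hj i ⟨u, hu.2, hu.1.2⟩
  have hcod : ∀ S ∈ F, ∀ a ∈ S, ∀ b ∈ S, a ≠ b → (leaves H a b).card ≤ 2 ^ c j := by
    intro S hS a ha b hb hab
    obtain ⟨i, hi, hi'⟩ := hlev S (hFH S hS)
    exact (hi' a ha b hb hab).trans (Nat.pow_le_pow_right (by norm_num) (hc (hle S hS i hi)))
  refine Solvable.mono (m := w j + (κ + c j)) ?_ subset_rfl (by have := hB j; omega)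
  -- The rainbow property leaves at most one vertex of a candidate in the colour class, and the
  -- previous stage ensures there is one.
  refine Solvable.search A ((Finset.card_le_card ?_).trans (hW j)) ?_ ?_
  · intro v hv
    exact (Finset.mem_filter.1 hv).2.2
  · rintro S ⟨hSH, hS⟩
    refine le_antisymm (Finset.card_le_one.2 ?_) (Finset.card_pos.2 ?_)
    · intro a ha b hb
      simp only [hA, Finset.mem_inter, Finset.mem_filter, Finset.mem_univ, true_and] at ha hb
      exact hχ S hSH ha.2 hb.2 (ha.1.1.trans hb.1.1.symm)
    · exact (hS (χ a₀, j)).2 ⟨a₀, by simp [ha₀, ha₀j]⟩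
  intro a _
  refine Solvable.mono (m := Fintype.card (Cov a) + (c j + 0)) ?_ subset_rfl
    (by have := hκ a; simp only [Fintype.card_coe]; omega)
  -- Individual tests on the cover of `a` reveal a second vertex of the edge.
  refine Solvable.stage_fintype (fun u : Cov a => {u.1} \ {a}) ?_
  rintro S₁ ⟨hS₁F, haS₁⟩
  obtain ⟨b, hbS₁, hba, hbC⟩ := hcov S₁ (hFH _ hS₁F) a haS₁
  refine Solvable.search (leaves H a b) (hcod S₁ hS₁F a haS₁ b hbS₁ hba.symm) ?_ ?_
  · rintro S ⟨⟨hS, haS⟩, hSb⟩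
    have hbS : b ∈ S := by
      have := (hSb ⟨b, hbC⟩).2 ⟨b, by simp [hbS₁, hba]⟩
      obtain ⟨x, hx⟩ := this
      simp only [Finset.mem_inter, Finset.mem_sdiff, Finset.mem_singleton] at hx
      exact hx.1.1 ▸ hx.2
    obtain ⟨x, hxa, hxb, rfl⟩ := exists_third (h3 S (hFH S hS)) haS hbS hba.symm
    refine Finset.card_eq_one.2 ⟨x, ?_⟩
    ext y
    simp only [Finset.mem_inter, mem_leaves, Finset.mem_insert, Finset.mem_singleton]
    constructor
    · rintro ⟨⟨h1, h2, -⟩, h3⟩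
      tauto
    · rintro rfl
      exact ⟨⟨hxa, hxb, hFH _ hS⟩, by simp⟩
  · intro x hx
    refine Solvable.of_subsingleton ?_
    obtain ⟨hxa, hxb, -⟩ := mem_leaves.1 hx
    have : ∀ S, S ∈ {S ∈ {S ∈ {S ∈ F | a ∈ S} | ∀ i : Cov a,
        (({i.1} \ {a} : Finset (Fin t)) ∩ S).Nonempty ↔
        (({i.1} \ {a} : Finset (Fin t)) ∩ S₁).Nonempty} | x ∈ S} → ({a, b, x} : Finset _) = S := by
      rintro S ⟨⟨⟨hS, haS⟩, hSb⟩, hxS⟩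
      have hbS : b ∈ S := by
        have := (hSb ⟨b, hbC⟩).2 ⟨b, by simp [hbS₁, hba]⟩
        obtain ⟨x, hx⟩ := this
        simp only [Finset.mem_inter, Finset.mem_sdiff, Finset.mem_singleton] at hx
        exact hx.1.1 ▸ hx.2
      refine Finset.eq_of_subset_of_card_le ?_ ?_
      · simp [Finset.insert_subset_iff, haS, hbS, hxS]
      · rw [h3 S (hFH S hS), Finset.card_eq_three.2 ⟨a, b, x, hba.symm, hxa.symm, hxb.symm, rfl⟩]
    intro S hS S' hS'
    exact (this S hS).symm.trans (this S' hS')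

/-! ### Counting words with a prescribed union -/

/-- The subsets of `Fin n` of size `w`. -/
abbrev WeightSet (n w : ℕ) : Type := {U : Finset (Fin n) // U.card = w}

/-- The union of a family of sets of size `w`. -/
def unionOf {n w : ℕ} {ι : Type*} [Fintype ι] (x : ι → WeightSet n w) : Finset (Fin n) :=
  Finset.univ.biUnion fun i => (x i).1

/-- The number of families of sets of size `w`, indexed by `ι`, that together with `z` have
union `y`. -/
def unionCount {n : ℕ} (w : ℕ) (ι : Type*) [Fintype ι] [DecidableEq ι]
    (z y : Finset (Fin n)) : ℕ :=
  (Finset.univ.filter fun x : ι → WeightSet n w => z ∪ unionOf x = y).card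

/-- Give each position the pattern of indices whose word contains it, with weight l^|pattern|; a
family has weight l^(kw), where k is the number of words. Summed over admissible patterns, a
position outside z contributes at most 1 whether or not y contains it, precisely because (1+l)^k =
2, and a position of z at most 2. -/
theorem unionCount_mul_pow_le {n w : ℕ} (ι : Type*) [Fintype ι] [DecidableEq ι]
    (z y : Finset (Fin n)) (l : ℝ) (hl : 0 ≤ l) (hl2 : (1 + l) ^ Fintype.card ι = 2) :
    (unionCount w ι z y : ℝ) * l ^ (Fintype.card ι * w) ≤ 2 ^ z.card := by
  let tr : (ι → WeightSet n w) → Fin n → Finset ι :=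
    fun x b => Finset.univ.filter fun i => b ∈ (x i).1
  let P : Fin n → Finset (Finset ι) :=
    fun b => Finset.univ.filter fun p => b ∈ y ↔ b ∈ z ∨ p.Nonempty
  have htr : Function.Injective tr := by
    intro x x' h
    funext i
    apply Subtype.ext
    ext b
    have := congrArg (fun q => i ∈ q) (congrFun h b)
    simpa [tr] using this
  have hcard : ∀ x, ∏ b, l ^ (tr x b).card = l ^ (Fintype.card ι * w) := by
    intro x
    rw [Finset.prod_pow_eq_pow_sum]
    congr 1
    have := Finset.sum_card_bipartiteAbove_eq_sum_card_bipartiteBelow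
      (s := (Finset.univ : Finset (Fin n))) (t := (Finset.univ : Finset ι))
      (fun b i => b ∈ (x i).1)
    simp only [Finset.bipartiteAbove, Finset.bipartiteBelow] at this
    simp only [tr]
    rw [this]
    simp [(x _).2]
  have htotal : ∑ p : Finset ι, l ^ p.card = 2 := by
    have := Finset.sum_pow_mul_eq_add_pow l 1 (Finset.univ : Finset ι)
    simp only [one_pow, mul_one, Finset.powerset_univ, Finset.card_univ] at this
    rw [this, add_comm, hl2]
  have hlocal : ∀ b, ∑ p ∈ P b, l ^ p.card ≤ if b ∈ z then 2 else 1 := by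
    intro b
    by_cases hz : b ∈ z
    · rw [if_pos hz, ← htotal]
      exact Finset.sum_le_sum_of_subset_of_nonneg (Finset.subset_univ _)
        fun _ _ _ => pow_nonneg hl _
    · rw [if_neg hz]
      by_cases hy : b ∈ y
      · have : P b = Finset.univ.erase ∅ := by
          ext p
          simp [P, hy, hz, Finset.nonempty_iff_ne_empty]
        rw [this]
        have h := Finset.add_sum_erase Finset.univ (fun p : Finset ι => l ^ p.card)
          (Finset.mem_univ ∅)
        simp only [Finset.card_empty, pow_zero] at h
        linarith
      · have : P b = {∅} := by
          ext p
          simp [P, hy, hz]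
        simp [this]
  calc (unionCount w ι z y : ℝ) * l ^ (Fintype.card ι * w)
      = ∑ x ∈ Finset.univ.filter fun x : ι → WeightSet n w => z ∪ unionOf x = y,
          ∏ b, l ^ (tr x b).card := by
        simp [hcard, unionCount]
    _ = ∑ p ∈ (Finset.univ.filter fun x : ι → WeightSet n w => z ∪ unionOf x = y).image tr,
          ∏ b, l ^ (p b).card := by
        rw [Finset.sum_image htr.injOn]
    _ ≤ ∑ p ∈ Fintype.piFinset P, ∏ b, l ^ (p b).card := by
        refine Finset.sum_le_sum_of_subset_of_nonneg ?_ fun _ _ _ =>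
          Finset.prod_nonneg fun _ _ => pow_nonneg hl _
        intro p hp
        obtain ⟨x, hx, rfl⟩ := Finset.mem_image.1 hp
        obtain rfl := (Finset.mem_filter.1 hx).2
        simp [P, tr, unionOf, Finset.Nonempty]
    _ = ∏ b, ∑ p ∈ P b, l ^ p.card := by
        rw [Finset.prod_univ_sum]
    _ ≤ ∏ b, (if b ∈ z then (2 : ℝ) else 1) :=
        Finset.prod_le_prod (fun _ _ => Finset.sum_nonneg fun _ _ => pow_nonneg hl _)
          fun b _ => hlocal b
    _ = 2 ^ z.card := by
        rw [Finset.prod_ite_mem]; simp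

/-- The largest term of the binomial expansion is at least the average. It sits near density
l/(1+l), slightly above 1/5 when l = 0.2599, which gives n ≤ 5w once n is not too small. -/
theorem exists_weight (l : ℝ) (hl : 0.2599 ≤ l) (n : ℕ) (hn : 130 ≤ n) :
    ∃ w ≤ n, n ≤ 5 * w ∧ (1 + l) ^ n ≤ (n + 1) * (n.choose w * l ^ w) := by
  have hl0 : 0 < l := by linarith
  obtain ⟨w, hw, hmax⟩ := Finset.exists_max_image (Finset.range (n + 1))
    (fun w => (n.choose w : ℝ) * l ^ w) ⟨0, by simp⟩
  have hwn : w ≤ n := Nat.lt_succ_iff.1 (Finset.mem_range.1 hw)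
  refine ⟨w, hwn, ?_, ?_⟩
  · by_contra! h
    have hlt : w < n := by omega
    have h1 := hmax (w + 1) (Finset.mem_range.2 (by omega))
    have h2 : (n.choose (w + 1) : ℝ) * (w + 1) = n.choose w * (n - w) := by
      have := Nat.choose_succ_right_eq n w
      rw [← Nat.cast_sub hwn]
      exact_mod_cast this
    have hc : (0 : ℝ) < n.choose w := by exact_mod_cast Nat.choose_pos hwn
    have hlw : 0 < l ^ w := pow_pos hl0 w
    have h3 : (n.choose (w + 1) : ℝ) * l ≤ n.choose w := by
      rw [pow_succ] at h1
      refine le_of_mul_le_mul_right ?_ hlw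
      linarith
    have h4 : ((n : ℝ) - w) * l ≤ w + 1 := by
      refine le_of_mul_le_mul_left ?_ hc
      have : (0 : ℝ) < w + 1 := by positivity
      calc (n.choose w : ℝ) * ((n - w) * l) = (n.choose (w + 1) * l) * (w + 1) := by
            rw [← mul_assoc, ← h2]; ring
        _ ≤ n.choose w * (w + 1) := by gcongr
    have h5 : (5 * w + 1 : ℝ) ≤ n := by exact_mod_cast h
    have h6 : (130 : ℝ) ≤ n := by exact_mod_cast hn
    have h7 : ((n : ℝ) - w) * 0.2599 ≤ w + 1 := by
      refine le_trans ?_ h4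
      have : (0 : ℝ) ≤ n - w := by linarith [(Nat.cast_nonneg w : (0 : ℝ) ≤ w)]
      gcongr
    linarith
  · rw [add_comm, add_pow]
    refine (Finset.sum_le_card_nsmul _ _ ((n.choose w : ℝ) * l ^ w) fun m hm => ?_).trans ?_
    · have := hmax m hm
      simp only [one_pow, mul_one]
      linarith
    · simp

theorem pow_le_pow_base {a b : ℝ} (k : ℕ) (hb : 0 ≤ b) (hk : k ≠ 0) (h : a ^ k ≤ b ^ k) :
    a ≤ b := le_of_pow_le_pow_left₀ hk hb h

-- With 1 + l = 2^(1/3) a union of three words has density about 1/2, so its entropy is maximal.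
-- Scaled to 2^(4Rr) random words, the bounds say: at most 2^((R+1)r) expected triples with union y,
-- at most 2^(-r) expected pairs completing one word, at most 2^((R+1)r) expected words completing a
-- pair. Polynomial factors in n are absorbed by 2^r.
set_option maxHeartbeats 1000000 in
theorem exists_good_weight (R : ℕ) (hR : 60 ≤ R) : ∀ᶠ r : ℕ in atTop, ∃ w : ℕ,
    0 < (11 * R * r).choose w ∧
    (∀ y : Finset (Fin (11 * R * r)), unionCount w (Fin 3) ∅ y * 2 ^ (11 * R * r) ≤
      2 ^ r * (11 * R * r).choose w ^ 3) ∧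
    (∀ z y : Finset (Fin (11 * R * r)), z.card ≤ w →
      unionCount w (Fin 2) z y * 2 ^ (8 * R * r + r) ≤ (11 * R * r).choose w ^ 2) ∧
    (∀ z y : Finset (Fin (11 * R * r)), z.card ≤ 2 * w →
      unionCount w (Fin 1) z y * 2 ^ (4 * R * r) ≤
        2 ^ ((R + 1) * r) * (11 * R * r).choose w) := by
  have hpoly : ∀ᶠ r : ℕ in atTop, (((11 * R * r : ℕ) : ℝ) + 1) ^ 3 ≤ 2 ^ r := by
    have h1 := tendsto_pow_const_div_const_pow_of_one_lt 3 (r := (2 : ℝ)) (by norm_num)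
    have hC : (0 : ℝ) < (11 * R + 1 : ℝ) ^ 3 := by positivity
    have h2 := h1.eventually (gt_mem_nhds (inv_pos.2 hC))
    filter_upwards [h2, eventually_ge_atTop 1] with r hr hr1
    have hr1' : (1 : ℝ) ≤ r := by exact_mod_cast hr1
    have h2r : (0 : ℝ) < 2 ^ r := by positivity
    rw [div_lt_iff₀ h2r, inv_mul_eq_div, lt_div_iff₀ hC] at hr
    refine le_trans ?_ hr.le
    rw [← mul_pow]
    push_cast
    gcongr
    nlinarith
  filter_upwards [hpoly, eventually_ge_atTop 1] with r hr hr1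
  set n := 11 * R * r with hn
  have hn130 : 130 ≤ n := by nlinarith [Nat.mul_le_mul hR hr1]
  obtain ⟨θ, hθ0, hθ⟩ : ∃ θ : ℝ, 0 ≤ θ ∧ θ ^ 3 = 2 :=
    ⟨(2 : ℝ) ^ ((1 : ℝ) / 3), by positivity, by
      rw [← Real.rpow_natCast, ← Real.rpow_mul (by norm_num)]; norm_num⟩
  have hθl : 1.2599 ≤ θ := pow_le_pow_base 3 hθ0 (by norm_num) (by rw [hθ]; norm_num)
  have hθu : θ ≤ 1.259922 := pow_le_pow_base 3 (by norm_num) (by norm_num) (by rw [hθ]; norm_num)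
  have h1θ : 1 + (θ - 1) = θ := by ring
  obtain ⟨w, hwn, hw5, hw⟩ := exists_weight (θ - 1) (by linarith) n hn130
  rw [h1θ] at hw
  set l := θ - 1 with hl
  have hl0 : 0 < l := by linarith
  set c : ℝ := (n.choose w : ℝ) with hc
  have hc0 : 0 < c := by rw [hc]; exact_mod_cast Nat.choose_pos hwn
  have hp1 : (1 : ℝ) ≤ n + 1 := by linarith [(Nat.cast_nonneg n : (0 : ℝ) ≤ n)]
  have hp0 : (0 : ℝ) ≤ n + 1 := by linarith
  have hθn : θ ^ (3 * n) = 2 ^ n := by rw [pow_mul, hθ]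
  refine ⟨w, Nat.choose_pos hwn, fun y => ?_, fun z y hz => ?_, fun z y hz => ?_⟩
  · have hA := unionCount_mul_pow_le (w := w) (Fin 3) ∅ y l hl0.le (by simp [hl, hθ])
    simp only [Fintype.card_fin, Finset.card_empty, pow_zero] at hA
    set N : ℝ := (unionCount w (Fin 3) ∅ y : ℝ)
    have hN : 0 ≤ N := Nat.cast_nonneg _
    have : N * 2 ^ n ≤ 2 ^ r * c ^ 3 := by
      calc N * 2 ^ n = N * (θ ^ n) ^ 3 := by rw [← hθn, mul_comm 3 n, pow_mul]
        _ ≤ N * ((n + 1) * (c * l ^ w)) ^ 3 := by gcongr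
        _ = (N * l ^ (3 * w)) * ((n + 1) ^ 3 * c ^ 3) := by
            rw [mul_comm 3 w, pow_mul]; ring
        _ ≤ 1 * (2 ^ r * c ^ 3) := by gcongr
        _ = _ := one_mul _
    simp only [N, hc] at this
    exact_mod_cast this
  · have hs1 : 1.41421 ≤ √2 := Real.le_sqrt_of_sq_le (by norm_num)
    have hB := unionCount_mul_pow_le (w := w) (Fin 2) z y (√2 - 1) (by linarith)
      (by simp)
    simp only [Fintype.card_fin] at hB
    set l2 : ℝ := √2 - 1
    have hl2 : 0.41421 ≤ l2 := by simp only [l2]; linarith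
    set N : ℝ := (unionCount w (Fin 2) z y : ℝ)
    have hN : 0 ≤ N := Nat.cast_nonneg _
    have hB' : N * (l2 ^ 2) ^ w ≤ 2 ^ w := by
      rw [← pow_mul]
      exact hB.trans (pow_le_pow_right₀ (by norm_num) hz)
    have hq : 2 * l ^ 2 ≤ 0.79 * l2 ^ 2 := by
      have h1 : l ^ 2 ≤ 0.259922 ^ 2 := by gcongr; linarith
      have h2 : (0.41421 : ℝ) ^ 2 ≤ l2 ^ 2 := by gcongr
      norm_num at h1 h2 ⊢
      linarith
    have h1 : N * (l ^ 2) ^ w ≤ 0.79 ^ w := by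
      have hpos : (0 : ℝ) < (l2 ^ 2) ^ w := by positivity
      refine le_of_mul_le_mul_right ?_ hpos
      have h2w : (0 : ℝ) < 2 ^ w := by positivity
      calc N * (l ^ 2) ^ w * (l2 ^ 2) ^ w = (N * (l2 ^ 2) ^ w) * (l ^ 2) ^ w := by ring
        _ ≤ 2 ^ w * (l ^ 2) ^ w := by gcongr
        _ = (2 * l ^ 2) ^ w := by rw [mul_pow]
        _ ≤ (0.79 * l2 ^ 2) ^ w := by gcongr
        _ = _ := by rw [mul_pow]
    have h2 : N * (θ ^ n) ^ 2 ≤ ((n + 1) * c) ^ 2 * 0.79 ^ w := by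
      calc N * (θ ^ n) ^ 2 ≤ N * ((n + 1) * (c * l ^ w)) ^ 2 := by gcongr
        _ = ((n + 1) * c) ^ 2 * (N * (l ^ 2) ^ w) := by rw [← pow_mul]; ring
        _ ≤ _ := by gcongr
    -- Since 0.79^15 · 2^5 ≤ 1 and n ≤ 5w, 0.79^w ≤ 2^(-n/15); with θ^(2n) = 2^(2n/3) the exponent
    -- is 11n/15. Fifteenth powers keep it integral.
    have h3 : N ^ 15 * 2 ^ (11 * n) ≤ (((n + 1) * c) ^ 2) ^ 15 := by
      have h79 : ((0.79 : ℝ) ^ w) ^ 15 * 2 ^ n ≤ 1 := by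
        calc ((0.79 : ℝ) ^ w) ^ 15 * 2 ^ n ≤ ((0.79 : ℝ) ^ w) ^ 15 * 2 ^ (5 * w) := by
              gcongr
              norm_num
          _ = (0.79 ^ 15 * 2 ^ 5) ^ w := by
              rw [mul_pow, ← pow_mul, ← pow_mul, ← pow_mul, mul_comm w]
          _ ≤ 1 := pow_le_one₀ (by norm_num) (by norm_num)
      calc N ^ 15 * 2 ^ (11 * n) = (N * (θ ^ n) ^ 2) ^ 15 * 2 ^ n := by
            rw [mul_pow, ← pow_mul, ← pow_mul, mul_assoc]
            congr 1
            rw [show n * (2 * 15) = 3 * n * 10 by ring, pow_mul θ, hθn, ← pow_mul, ← pow_add]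
            congr 1
            ring
        _ ≤ (((n + 1) * c) ^ 2 * 0.79 ^ w) ^ 15 * 2 ^ n := by gcongr
        _ = (((n + 1) * c) ^ 2) ^ 15 * ((0.79 ^ w) ^ 15 * 2 ^ n) := by ring
        _ ≤ (((n + 1) * c) ^ 2) ^ 15 * 1 := by gcongr
        _ = _ := mul_one _
    -- As 11 · 11/15 = 8 + 1/15, the surplus Rr/15 covers 4r exactly when R ≥ 60.
    have h4 : N * 2 ^ (8 * R * r + 4 * r) ≤ ((n + 1) * c) ^ 2 := by
      refine pow_le_pow_base 15 (by positivity) (by norm_num) (le_trans ?_ h3)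
      rw [mul_pow, ← pow_mul]
      refine mul_le_mul_of_nonneg_left (pow_le_pow_right₀ (by norm_num) ?_) (by positivity)
      rw [hn]
      nlinarith [Nat.mul_le_mul_right r hR]
    have h5 : ((n : ℝ) + 1) ^ 2 ≤ 2 ^ r := le_trans (pow_le_pow_right₀ hp1 (by norm_num)) hr
    have h6 : N * 2 ^ (8 * R * r + r) ≤ c ^ 2 := by
      have h2r : (0 : ℝ) < 2 ^ r := by positivity
      refine le_of_mul_le_mul_right ?_ h2r
      calc N * 2 ^ (8 * R * r + r) * 2 ^ r = N * 2 ^ (8 * R * r + 2 * r) := by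
            rw [mul_assoc, ← pow_add]; congr 2; ring
        _ ≤ N * 2 ^ (8 * R * r + 4 * r) := by
            gcongr
            · norm_num
            · norm_num
        _ ≤ ((n + 1) * c) ^ 2 := h4
        _ = c ^ 2 * (n + 1) ^ 2 := by ring
        _ ≤ c ^ 2 * 2 ^ r := by gcongr
    simp only [N, hc] at h6
    exact_mod_cast h6
  · have hC := unionCount_mul_pow_le (w := w) (Fin 1) z y 1 zero_le_one (by norm_num)
    simp only [Fintype.card_fin, one_pow, mul_one] at hC
    set N : ℝ := (unionCount w (Fin 1) z y : ℝ)
    have hN : 0 ≤ N := Nat.cast_nonneg _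
    have hC' : N ≤ 4 ^ w := by
      refine hC.trans ((pow_le_pow_right₀ (by norm_num) hz).trans ?_)
      rw [pow_mul]; norm_num
    have h1 : N * θ ^ n ≤ ((n + 1) * c) * (4 * l) ^ w := by
      calc N * θ ^ n ≤ 4 ^ w * ((n + 1) * (c * l ^ w)) := by gcongr
        _ = _ := by rw [mul_pow]; ring
    have h4l : (4 * l) ^ 17 ≤ 2 := by
      calc (4 * l) ^ 17 ≤ 1.039688 ^ 17 := by gcongr; linarith
        _ ≤ 2 := by norm_num
    -- Here (4l)^w ≤ 2^(n/17), and n/3 - n/17 = 14n/51, which exceeds 3Rr.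
    have h2 : N ^ 51 * 2 ^ (14 * n) ≤ ((n + 1) * c) ^ 51 := by
      have h2n : (0 : ℝ) < 2 ^ (3 * n) := by positivity
      refine le_of_mul_le_mul_right ?_ h2n
      calc N ^ 51 * 2 ^ (14 * n) * 2 ^ (3 * n) = (N * θ ^ n) ^ 51 := by
            rw [mul_pow, ← pow_mul, show n * 51 = 3 * n * 17 by ring, pow_mul θ, hθn, ← pow_mul,
              mul_assoc, ← pow_add]
            congr 2
            ring
        _ ≤ (((n + 1) * c) * (4 * l) ^ w) ^ 51 := by gcongr
        _ = ((n + 1) * c) ^ 51 * ((4 * l) ^ 17) ^ (3 * w) := by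
            rw [mul_pow, ← pow_mul, ← pow_mul]; congr 2; ring
        _ ≤ ((n + 1) * c) ^ 51 * 2 ^ (3 * w) := by gcongr
        _ ≤ ((n + 1) * c) ^ 51 * 2 ^ (3 * n) := by
            gcongr
            norm_num
    have h3 : N * 2 ^ (4 * R * r) ≤ 2 ^ (R * r) * ((n + 1) * c) := by
      have h2n : (0 : ℝ) < 2 ^ (14 * n) := by positivity
      refine pow_le_pow_base 51 (by positivity) (by norm_num) (le_of_mul_le_mul_right ?_ h2n)
      calc (N * 2 ^ (4 * R * r)) ^ 51 * 2 ^ (14 * n)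
          = (N ^ 51 * 2 ^ (14 * n)) * 2 ^ (4 * R * r * 51) := by
            rw [mul_pow, ← pow_mul]; ring
        _ ≤ ((n + 1) * c) ^ 51 * 2 ^ (4 * R * r * 51) := by gcongr
        _ ≤ ((n + 1) * c) ^ 51 * 2 ^ (R * r * 51 + 14 * n) := by
            refine mul_le_mul_of_nonneg_left (pow_le_pow_right₀ (by norm_num) ?_) (by positivity)
            rw [hn]
            nlinarith [Nat.zero_le (R * r)]
        _ = _ := by rw [mul_pow (2 ^ (R * r)), ← pow_mul, pow_add]; ring
    have h5 : ((n : ℝ) + 1) ≤ 2 ^ r := le_trans (le_self_pow₀ hp1 (by norm_num)) hr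
    have h6 : N * 2 ^ (4 * R * r) ≤ 2 ^ ((R + 1) * r) * c := by
      calc N * 2 ^ (4 * R * r) ≤ 2 ^ (R * r) * ((n + 1) * c) := h3
        _ ≤ 2 ^ (R * r) * (2 ^ r * c) := by gcongr
        _ = _ := by rw [add_mul, one_mul, pow_add]; ring
    simp only [N, hc] at h6
    exact_mod_cast h6

/-! ### Matchings in a random code -/

section RandomCode

variable {I α β : Type*} [DecidableEq β]

/-- The union of the codewords of the samples in `e`. -/
def codeUnion (u : α → Finset β) (f : I → α) (e : Finset I) : Finset β :=
  e.biUnion fun i => u (f i)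

theorem codeUnion_congr (u : α → Finset β) {f g : I → α} {e : Finset I}
    (h : ∀ i ∈ e, f i = g i) : codeUnion u f e = codeUnion u g e :=
  Finset.biUnion_congr rfl fun i hi => by rw [h i hi]

/-- Every family of pairwise disjoint `s`-sets that avoid `F` and whose codeword unions are
`Rel`-related to that of `F` has fewer than `N` members. -/
def NoLargeMatching (u : α → Finset β) (f : I → α) (F : Finset I) (s : ℕ)
    (Rel : Finset β → Finset β → Prop) (N : ℕ) : Prop :=
  ∀ M : Finset (Finset I), (∀ e ∈ M, e.card = s ∧ Disjoint F e ∧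
    Rel (codeUnion u f F) (codeUnion u f e)) →
    (M : Set (Finset I)).PairwiseDisjoint id → M.card < N

set_option linter.unusedSectionVars false

variable [Fintype I] [DecidableEq I] [Fintype α] [DecidableEq α]

theorem card_agree_off (e : Finset I) (g : I → α) :
    (Finset.univ.filter fun f : I → α => ∀ i ∉ e, f i = g i).card = Fintype.card α ^ e.card := by
  have : (Finset.univ.filter fun f : I → α => ∀ i ∉ e, f i = g i) =
      Fintype.piFinset fun i => if i ∈ e then Finset.univ else {g i} := by
    ext f
    simp only [Finset.mem_filter, Finset.mem_univ, true_and, Fintype.mem_piFinset]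
    refine forall_congr' fun i => ?_
    by_cases h : i ∈ e <;> simp [h]
  rw [this, Fintype.card_piFinset]
  simp only [apply_ite Finset.card, Finset.card_univ, Finset.card_singleton]
  rw [Finset.prod_ite_mem]
  simp

/-- Resampling the coordinates in `e`, by double counting pairs of codes that agree off `e`: the
event `A` ignores these coordinates, and `G` holds for at most `c` of their values. -/
theorem card_filter_mul_pow_le (e : Finset I) (A : Finset (I → α)) (G : (I → α) → Prop)
    [DecidablePred G] (hA : ∀ f g : I → α, (∀ i ∉ e, f i = g i) → f ∈ A → g ∈ A) (c : ℕ)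
    (hc : ∀ f : I → α, (Finset.univ.filter fun g => (∀ i ∉ e, g i = f i) ∧ G g).card ≤ c) :
    (A.filter G).card * Fintype.card α ^ e.card ≤ A.card * c := by
  refine Finset.card_mul_le_card_mul (fun f g => ∀ i ∉ e, g i = f i) (fun f hf => ?_)
    (fun g hg => ?_)
  · rw [← card_agree_off e f]
    refine Finset.card_le_card fun g hg => ?_
    simp only [Finset.mem_filter, Finset.mem_univ, true_and] at hg
    simp only [Finset.bipartiteAbove, Finset.mem_filter]
    exact ⟨hA f g (fun i hi => (hg i hi).symm) (Finset.mem_filter.1 hf).1, hg⟩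
  · refine (Finset.card_le_card fun f hf => ?_).trans (hc g)
    simp only [Finset.bipartiteBelow, Finset.mem_filter] at hf
    simp only [Finset.mem_filter, Finset.mem_univ, true_and]
    exact ⟨fun i hi => (hf.2 i hi).symm, hf.1.2⟩

theorem card_extensions_le (u : α → Finset β) (F e : Finset I) (s : ℕ) (hes : e.card = s)
    (hFe : Disjoint F e) (Rel : Finset β → Finset β → Prop) [DecidableRel Rel] (f : I → α) :
    (Finset.univ.filter fun g : I → α => (∀ i ∉ e, g i = f i) ∧
      Rel (codeUnion u g F) (codeUnion u g e)).card ≤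
    (Finset.univ.filter fun x : Fin s → α =>
      Rel (codeUnion u f F) (Finset.univ.biUnion fun i => u (x i))).card := by
  let en := Finset.equivFinOfCardEq hes
  refine Finset.card_le_card_of_injOn (fun g i => g (en.symm i)) ?_ ?_
  · intro g hg
    simp only [Finset.coe_filter, Finset.mem_univ, true_and, Set.mem_ofPred_eq] at hg ⊢
    have h1 : codeUnion u g F = codeUnion u f F :=
      codeUnion_congr u fun i hi => hg.1 i (Finset.disjoint_left.1 hFe hi)
    have h2 : codeUnion u g e = Finset.univ.biUnion fun i => u (g (en.symm i)) := by
      ext b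
      simp only [codeUnion, Finset.mem_biUnion, Finset.mem_univ, true_and]
      constructor
      · rintro ⟨i, hi, hb⟩
        exact ⟨en ⟨i, hi⟩, by simpa using hb⟩
      · rintro ⟨i, hb⟩
        exact ⟨_, (en.symm i).2, hb⟩
    rw [← h1, ← h2]
    exact hg.2
  · intro g hg g' hg' h
    simp only [Finset.coe_filter, Finset.mem_univ, true_and, Set.mem_ofPred_eq] at hg hg'
    funext i
    by_cases hi : i ∈ e
    · have := congrFun h (en ⟨i, hi⟩)
      simpa using this
    · rw [hg.1 i hi, hg'.1 i hi]

/-- The sets `σ i` use separate coordinates, so given the words on `F` the k events are independent,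
each of probability at most c/|α|^s. -/
theorem card_forall_mul_pow_le (u : α → Finset β) (F : Finset I) (s : ℕ)
    (Rel : Finset β → Finset β → Prop) [DecidableRel Rel] (c : ℕ)
    (hc : ∀ f : I → α, (Finset.univ.filter fun x : Fin s → α =>
      Rel (codeUnion u f F) (Finset.univ.biUnion fun i => u (x i))).card ≤ c)
    {k : ℕ} (σ : Fin k → Finset I) (hσs : ∀ i, (σ i).card = s) (hσF : ∀ i, Disjoint F (σ i))
    (hσ : Pairwise fun i j => Disjoint (σ i) (σ j)) :
    (Finset.univ.filter fun f : I → α => ∀ i,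
      Rel (codeUnion u f F) (codeUnion u f (σ i))).card * (Fintype.card α ^ s) ^ k ≤
      c ^ k * Fintype.card α ^ Fintype.card I := by
  suffices h : ∀ J : Finset (Fin k), (Finset.univ.filter fun f : I → α => ∀ i ∈ J,
      Rel (codeUnion u f F) (codeUnion u f (σ i))).card * (Fintype.card α ^ s) ^ J.card ≤
      c ^ J.card * Fintype.card α ^ Fintype.card I by
    simpa using h Finset.univ
  intro J
  induction J using Finset.induction_on with
  | empty => simp
  | insert a J ha ih =>
    rw [Finset.card_insert_of_notMem ha]
    have step := card_filter_mul_pow_le (σ a)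
      (Finset.univ.filter fun f : I → α => ∀ i ∈ J, Rel (codeUnion u f F) (codeUnion u f (σ i)))
      (fun f => Rel (codeUnion u f F) (codeUnion u f (σ a))) (fun f g hfg hf => ?_) c
      (fun f => (card_extensions_le u F (σ a) s (hσs a) (hσF a) Rel f).trans (hc f))
    · rw [hσs a, Finset.filter_filter] at step
      have heq : (Finset.univ.filter fun f : I → α => ∀ i ∈ insert a J,
          Rel (codeUnion u f F) (codeUnion u f (σ i))) =
          Finset.univ.filter fun f : I → α =>
            (∀ i ∈ J, Rel (codeUnion u f F) (codeUnion u f (σ i))) ∧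
            Rel (codeUnion u f F) (codeUnion u f (σ a)) := by
        ext f
        simp [and_comm]
      rw [heq, pow_succ, mul_comm (_ ^ J.card), ← mul_assoc]
      refine (Nat.mul_le_mul_right _ step).trans ?_
      rw [mul_right_comm, pow_succ, mul_right_comm (c ^ J.card)]
      exact Nat.mul_le_mul_right _ ih
    · simp only [Finset.mem_filter, Finset.mem_univ, true_and] at hf ⊢
      intro i hi
      have h1 : codeUnion u f F = codeUnion u g F :=
        codeUnion_congr u fun x hx => hfg x (Finset.disjoint_left.1 (hσF a) hx)
      have h2 : codeUnion u f (σ i) = codeUnion u g (σ i) :=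
        codeUnion_congr u fun x hx => hfg x
          (Finset.disjoint_left.1 (hσ (fun h => ha (h ▸ hi) : i ≠ a)) hx)
      rw [← h1, ← h2]
      exact hf i hi

-- A matching with at least `N` members contains at least (N+1-k)^k ordered k-tuples of distinct
-- members; compare with the expected number of such tuples.
open Classical in
theorem card_large_matching_mul_le (u : α → Finset β) (F : Finset I) {s : ℕ}
    (Rel : Finset β → Finset β → Prop) (N k c : ℕ)
    (hc : ∀ f : I → α, (Finset.univ.filter fun x : Fin s → α =>
      Rel (codeUnion u f F) (Finset.univ.biUnion fun i => u (x i))).card ≤ c) :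
    (Finset.univ.filter fun f : I → α => ¬ NoLargeMatching u f F s Rel N).card *
      (N + 1 - k) ^ k * (Fintype.card α ^ s) ^ k ≤
      (Fintype.card I ^ s) ^ k * (c ^ k * Fintype.card α ^ Fintype.card I) := by
  let r : (I → α) → (Fin k → Finset I) → Prop := fun f σ =>
    (∀ i, Disjoint F (σ i)) ∧ (Pairwise fun i j => Disjoint (σ i) (σ j)) ∧
      ∀ i, Rel (codeUnion u f F) (codeUnion u f (σ i))
  let B := Finset.univ.filter fun f : I → α => ¬ NoLargeMatching u f F s Rel N
  let Tup : Finset (Fin k → Finset I) :=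
    Fintype.piFinset fun _ => Finset.univ.powersetCard s
  have hTup : Tup.card ≤ (Fintype.card I ^ s) ^ k := by
    simp only [Tup, Fintype.card_piFinset, Finset.card_powersetCard, Finset.card_univ,
      Finset.prod_const, Fintype.card_fin]
    exact Nat.pow_le_pow_left (Nat.choose_le_pow _ _) _
  have hlow : ∀ f ∈ B, (N + 1 - k) ^ k ≤ (Finset.bipartiteAbove r Tup f).card := by
    intro f hf
    simp only [B, Finset.mem_filter, Finset.mem_univ, true_and, NoLargeMatching, not_forall,
      not_lt] at hf
    obtain ⟨M, hM, hdisj, hN⟩ := hf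
    have h1 : (N + 1 - k) ^ k ≤ (Finset.univ : Finset (Fin k ↪ M)).card := by
      rw [Finset.card_univ, Fintype.card_embedding_eq, Fintype.card_coe, Fintype.card_fin]
      exact (Nat.pow_le_pow_left (by omega) _).trans (Nat.pow_sub_le_descFactorial _ _)
    refine h1.trans (Finset.card_le_card_of_injOn (fun τ i => (τ i).1) ?_ ?_)
    · intro τ _
      simp only [Finset.bipartiteAbove, Finset.coe_filter, Set.mem_ofPred_eq, Tup,
        Fintype.mem_piFinset, Finset.mem_powersetCard, Finset.subset_univ, true_and, r]
      refine ⟨fun i => (hM _ (τ i).2).1, fun i => (hM _ (τ i).2).2.1, fun i j hij => ?_,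
        fun i => (hM _ (τ i).2).2.2⟩
      exact hdisj (τ i).2 (τ j).2 fun h => hij (τ.injective (Subtype.ext h))
    · intro τ _ τ' _ h
      ext i
      have := congrFun h i
      simp only at this
      rw [this]
  have hup : ∀ σ ∈ Tup, (Finset.bipartiteBelow r B σ).card * (Fintype.card α ^ s) ^ k ≤
      c ^ k * Fintype.card α ^ Fintype.card I := by
    intro σ hσ
    by_cases h : (∀ i, Disjoint F (σ i)) ∧ (Pairwise fun i j => Disjoint (σ i) (σ j))
    · simp only [Tup, Fintype.mem_piFinset, Finset.mem_powersetCard, Finset.subset_univ,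
        true_and] at hσ
      refine le_trans (Nat.mul_le_mul_right _ (Finset.card_le_card fun f hf => ?_))
        (card_forall_mul_pow_le u F s Rel c hc σ hσ h.1 h.2)
      simp only [Finset.bipartiteBelow, Finset.mem_filter] at hf
      simpa using hf.2.2.2
    · have : Finset.bipartiteBelow r B σ = ∅ := by
        refine Finset.filter_eq_empty_iff.2 fun f _ hr => h ⟨hr.1, hr.2.1⟩
      rw [this]
      simp
  calc B.card * (N + 1 - k) ^ k * (Fintype.card α ^ s) ^ k
      ≤ (∑ f ∈ B, (Finset.bipartiteAbove r Tup f).card) * (Fintype.card α ^ s) ^ k := by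
        refine Nat.mul_le_mul_right _ ?_
        rw [← smul_eq_mul]
        exact Finset.card_nsmul_le_sum _ _ _ hlow
    _ = ∑ σ ∈ Tup, (Finset.bipartiteBelow r B σ).card * (Fintype.card α ^ s) ^ k := by
        rw [Finset.sum_card_bipartiteAbove_eq_sum_card_bipartiteBelow, Finset.sum_mul]
    _ ≤ Tup.card * (c ^ k * Fintype.card α ^ Fintype.card I) := by
        rw [← smul_eq_mul]
        exact Finset.sum_le_card_nsmul _ _ _ hup
    _ ≤ _ := Nat.mul_le_mul_right _ hTup

-- If the expected number of related sets is at most Q · 2^(-r) and `N` exceeds `Q` by about k,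
-- failure has probability at most 2^(-rk). A large k pays for a union bound over all outcomes.
open Classical in
theorem card_large_matching_mul_two_pow_le [Nonempty α] [Nonempty I] (u : α → Finset β)
    (F : Finset I) {s : ℕ} (Rel : Finset β → Finset β → Prop) {N k Q r : ℕ}
    (hk : k ≠ 0) (hQ : Q ≤ N + 1 - k) (hN : k ≤ N)
    (hc : ∀ (f : I → α) (A : Finset (Fin s → α)),
      (∀ x ∈ A, Rel (codeUnion u f F) (Finset.univ.biUnion fun i => u (x i))) →
        A.card * (Fintype.card I ^ s * 2 ^ r) ≤ Q * Fintype.card α ^ s) :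
    (Finset.univ.filter fun f : I → α => ¬ NoLargeMatching u f F s Rel N).card *
      2 ^ (r * k) ≤ Fintype.card (I → α) := by
  have hI : 0 < Fintype.card I := Fintype.card_pos
  have hα : 0 < Fintype.card α := Fintype.card_pos
  have hD : 0 < Fintype.card I ^ s * 2 ^ r := by positivity
  set c := Q * Fintype.card α ^ s / (Fintype.card I ^ s * 2 ^ r) with hcdef
  have hcD : c * (Fintype.card I ^ s * 2 ^ r) ≤ Q * Fintype.card α ^ s := Nat.div_mul_le_self _ _
  have main := card_large_matching_mul_le u F Rel N k c
    (fun f => (Nat.le_div_iff_mul_le hD).2 (hc f _ fun x hx => (Finset.mem_filter.1 hx).2))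
  set b := (Finset.univ.filter fun f : I → α => ¬ NoLargeMatching u f F s Rel N).card
  rw [Fintype.card_fun]
  have hα' : 0 < (Fintype.card α ^ s) ^ k := by positivity
  -- The rounded-down count may vanish, and then c^k cannot be cancelled; in that case no code is
  -- bad.
  rcases Nat.eq_zero_or_pos c with h0 | hpos
  · rw [h0, zero_pow hk, zero_mul, mul_zero] at main
    have h1 : 0 < (N + 1 - k) ^ k := Nat.pow_pos (by omega)
    have h2 : b = 0 := by
      by_contra hb
      have hb : 0 < b := Nat.pos_of_ne_zero hb
      have := Nat.mul_pos (Nat.mul_pos hb h1) hα'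
      omega
    simp [h2]
  · have hX : 0 < (Fintype.card I ^ s) ^ k * c ^ k := by positivity
    refine Nat.le_of_mul_le_mul_left ?_ hX
    calc (Fintype.card I ^ s) ^ k * c ^ k * (b * 2 ^ (r * k))
        = b * (c * (Fintype.card I ^ s * 2 ^ r)) ^ k := by
          rw [pow_mul, mul_pow, mul_pow]; ring
      _ ≤ b * ((N + 1 - k) * Fintype.card α ^ s) ^ k := by
          refine Nat.mul_le_mul_left _ (Nat.pow_le_pow_left (hcD.trans ?_) _)
          exact Nat.mul_le_mul_right _ hQ
      _ = b * (N + 1 - k) ^ k * (Fintype.card α ^ s) ^ k := by rw [mul_pow]; ring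
      _ ≤ _ := main
      _ = _ := by ring

theorem exists_forall_notMem_of_card_mul_le {Ω ι : Type*} [Fintype Ω] [Nonempty Ω]
    [DecidableEq Ω] [Fintype ι] (bad : ι → Finset Ω) (m : ℕ) (hι : Fintype.card ι < m)
    (h : ∀ i, (bad i).card * m ≤ Fintype.card Ω) : ∃ ω, ∀ i, ω ∉ bad i := by
  by_contra! hcon
  have h1 : Fintype.card Ω ≤ ∑ i, (bad i).card := by
    rw [← Finset.card_univ]
    refine (Finset.card_le_card fun ω _ => ?_).trans
      (Finset.card_biUnion_le (s := Finset.univ) (t := bad))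
    simpa using hcon ω
  have h2 : Fintype.card Ω * m ≤ Fintype.card ι * Fintype.card Ω := by
    refine (Nat.mul_le_mul_right m h1).trans ?_
    rw [Finset.sum_mul]
    exact (Finset.sum_le_card_nsmul _ _ _ fun i _ => h i).trans (by simp)
  have hΩ : 0 < Fintype.card Ω := Fintype.card_pos
  nlinarith

end RandomCode

/-! ### Existence of the code -/

/-- A pair of words with a completing third word is a triple with union y; this is the total for
Markov's inequality on pairs of large expected codegree. -/
theorem sum_unionCount_le {n w : ℕ} (y : Finset (Fin n)) (A : Finset (Fin 2 → WeightSet n w)) :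
    ∑ x ∈ A, unionCount w (Fin 1) (unionOf x) y ≤ unionCount w (Fin 3) ∅ y := by
  unfold unionCount
  rw [← Finset.card_sigma]
  refine Finset.card_le_card_of_injOn (fun p => ![p.1 0, p.1 1, p.2 0]) ?_ ?_
  · rintro ⟨x, c⟩ h
    simp only [Finset.coe_sigma, Set.mem_sigma_iff, Finset.coe_filter, Finset.mem_univ, true_and,
      Set.mem_ofPred_eq] at h ⊢
    rw [← h.2]
    ext b
    simp [unionOf, Fin.exists_fin_succ, or_assoc]
  · rintro ⟨x, c⟩ - ⟨x', c'⟩ - h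
    have h0 := congrFun h 0
    have h1 := congrFun h 1
    have h2 := congrFun h 2
    simp only [Matrix.cons_val] at h0 h1 h2
    obtain rfl : x = x' := by
      funext i; fin_cases i <;> assumption
    obtain rfl : c = c' := by
      funext i; fin_cases i; assumption
    rfl

theorem card_weightSet (n w : ℕ) : Fintype.card (WeightSet n w) = n.choose w := by
  simp

theorem exists_code (R : ℕ) (hR : 60 ≤ R) : ∀ᶠ r : ℕ in atTop, ∃ w : ℕ,
    ∃ f : Fin (2 ^ (4 * R * r)) → WeightSet (11 * R * r) w, ∀ y,
    NoLargeMatching Subtype.val f ∅ 3 (fun z x => z ∪ x = y) (20 * R + 2 ^ ((R + 2) * r)) ∧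
    (∀ j ≤ R, NoLargeMatching Subtype.val f ∅ 2
      (fun _ x => 2 ^ (j * r) * (11 * R * r).choose w <
        unionCount w (Fin 1) x y * 2 ^ (4 * R * r)) (20 * R + 2 ^ ((R + 2 - j) * r))) ∧
    (∀ v, NoLargeMatching Subtype.val f {v} 2 (fun z x => z ∪ x = y) (20 * R)) ∧
    (∀ j ≤ R + 1, ∀ a b, NoLargeMatching Subtype.val f {a, b} 1
      (fun z x => unionCount w (Fin 1) z y * 2 ^ (4 * R * r) ≤
        2 ^ (j * r) * (11 * R * r).choose w ∧ z ∪ x = y) (20 * R + 2 ^ ((j + 1) * r))) ∧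
    (∀ a b, unionCount w (Fin 1) (codeUnion Subtype.val f {a, b}) y * 2 ^ (4 * R * r) ≤
      2 ^ ((R + 1) * r) * (11 * R * r).choose w) := by
  classical
  filter_upwards [exists_good_weight R hR, eventually_ge_atTop 1] with r ⟨w, hpos, h3, h2, h1⟩ hr
  refine ⟨w, ?_⟩
  set n := 11 * R * r with hn
  set c := n.choose w with hc
  have hcard : Fintype.card (WeightSet n w) = c := card_weightSet n w
  have : Nonempty (WeightSet n w) := Fintype.card_pos_iff.1 (by rw [hcard]; exact hpos)
  have : Nonempty (Fin (2 ^ (4 * R * r))) := ⟨⟨0, by positivity⟩⟩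
  have hfive : ∀ (f : Fin (2 ^ (4 * R * r)) → WeightSet n w) (a b) (y),
      unionCount w (Fin 1) (codeUnion Subtype.val f {a, b}) y * 2 ^ (4 * R * r) ≤
        2 ^ ((R + 1) * r) * c := fun f a b y => by
    refine h1 _ y ((Finset.card_biUnion_le_card_mul _ _ w fun i _ => (f i).2.le).trans ?_)
    exact Nat.mul_le_mul_right _ Finset.card_le_two
  have hk : 20 * R ≠ 0 := by omega
  let ι := Finset (Fin n) × (Unit ⊕ Fin (R + 1) ⊕ Fin (2 ^ (4 * R * r)) ⊕
    (Fin (R + 2) × Fin (2 ^ (4 * R * r)) × Fin (2 ^ (4 * R * r))))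
  let P : ι → (Fin (2 ^ (4 * R * r)) → WeightSet n w) → Prop := fun i f =>
    match i with
    | (y, .inl _) =>
      NoLargeMatching Subtype.val f ∅ 3 (fun z x => z ∪ x = y) (20 * R + 2 ^ ((R + 2) * r))
    | (y, .inr (.inl j)) => NoLargeMatching Subtype.val f ∅ 2
      (fun _ x => 2 ^ (j.1 * r) * c < unionCount w (Fin 1) x y * 2 ^ (4 * R * r))
      (20 * R + 2 ^ ((R + 2 - j.1) * r))
    | (y, .inr (.inr (.inl v))) =>
      NoLargeMatching Subtype.val f {v} 2 (fun z x => z ∪ x = y) (20 * R)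
    | (y, .inr (.inr (.inr (j, a, b)))) => NoLargeMatching Subtype.val f {a, b} 1
      (fun z x => unionCount w (Fin 1) z y * 2 ^ (4 * R * r) ≤
        2 ^ (j.1 * r) * c ∧ z ∪ x = y) (20 * R + 2 ^ ((j.1 + 1) * r))
  suffices h : ∃ f, ∀ i, P i f by
    obtain ⟨f, hf⟩ := h
    exact ⟨f, fun y => ⟨hf (y, .inl ()), fun j hj => hf (y, .inr (.inl ⟨j, by omega⟩)),
      fun v => hf (y, .inr (.inr (.inl v))),
      fun j hj a b => hf (y, .inr (.inr (.inr (⟨j, by omega⟩, a, b)))),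
      fun a b => hfive f a b y⟩⟩
  -- Events are indexed by 2^(11Rr) outcomes and at most about 2^(8Rr) pairs; a further 2^(Rr)
  -- covers the constants, whence k = 20R.
  have hcount : Fintype.card ι < 2 ^ (r * (20 * R)) := by
    simp only [ι, Fintype.card_prod, Fintype.card_sum, Fintype.card_unit, Fintype.card_fin,
      Fintype.card_finset]
    have hT : 1 ≤ 2 ^ (4 * R * r) := Nat.one_le_two_pow
    have hlin : 2 * R + 5 < 2 ^ (R * r) := by
      refine lt_of_lt_of_le ?_ (Nat.pow_le_pow_right (by norm_num) (Nat.le_mul_of_pos_right R hr))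
      obtain ⟨q, rfl⟩ := Nat.exists_eq_add_of_le hR
      have : q < 2 ^ q := Nat.lt_two_pow_self
      rw [pow_add]
      have h60 : (1000 : ℕ) ≤ 2 ^ 60 := by norm_num
      nlinarith
    calc 2 ^ n * (1 + (R + 1 + (2 ^ (4 * R * r) + (R + 2) * (2 ^ (4 * R * r) * 2 ^ (4 * R * r)))))
        ≤ 2 ^ n * ((2 * R + 5) * (2 ^ (4 * R * r) * 2 ^ (4 * R * r))) := by
          refine Nat.mul_le_mul_left _ ?_
          generalize 2 ^ (4 * R * r) = T at hT
          nlinarith [Nat.mul_le_mul hT hT]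
      _ < 2 ^ n * (2 ^ (R * r) * (2 ^ (4 * R * r) * 2 ^ (4 * R * r))) := by
          refine Nat.mul_lt_mul_of_pos_left ?_ (by positivity)
          exact Nat.mul_lt_mul_of_pos_right hlin (by positivity)
      _ = 2 ^ (r * (20 * R)) := by
          rw [← pow_add, ← pow_add, ← pow_add, hn]
          congr 1
          ring
  have hbad : ∀ i : ι, (Finset.univ.filter fun f => ¬ P i f).card * 2 ^ (r * (20 * R)) ≤
      Fintype.card (Fin (2 ^ (4 * R * r)) → WeightSet n w) := by
    have hN : ∀ a : ℕ, 2 ^ a ≤ 20 * R + 2 ^ a + 1 - 20 * R := fun a => by omega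
    rintro ⟨y, _ | j | v | ⟨j, a, b⟩⟩
    · refine card_large_matching_mul_two_pow_le _ _ _ hk (hN _) (Nat.le_add_right _ _)
        fun f A hA => ?_
      rw [hcard, Fintype.card_fin]
      have hAc : A.card ≤ unionCount w (Fin 3) ∅ y := Finset.card_le_card fun x hx => by
        simpa [codeUnion, unionOf] using hA x hx
      calc A.card * ((2 ^ (4 * R * r)) ^ 3 * 2 ^ r)
          ≤ unionCount w (Fin 3) ∅ y * ((2 ^ (4 * R * r)) ^ 3 * 2 ^ r) :=
            Nat.mul_le_mul_right _ hAc
        _ = (unionCount w (Fin 3) ∅ y * 2 ^ n) * 2 ^ (R * r + r) := by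
            rw [mul_assoc _ (2 ^ n), ← pow_mul, ← pow_add, ← pow_add]
            congr 2
            rw [hn]
            ring
        _ ≤ (2 ^ r * c ^ 3) * 2 ^ (R * r + r) := Nat.mul_le_mul_right _ (h3 y)
        _ = 2 ^ ((R + 2) * r) * c ^ 3 := by
            rw [mul_right_comm, ← pow_add]
            congr 2
            ring
    · refine card_large_matching_mul_two_pow_le _ _ _ hk (hN _) (Nat.le_add_right _ _)
        fun f A hA => ?_
      rw [hcard, Fintype.card_fin]
      have hmarkov : A.card * (2 ^ (j.1 * r) * c) ≤
          unionCount w (Fin 3) ∅ y * 2 ^ (4 * R * r) := by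
        refine le_trans ?_ (Nat.mul_le_mul_right _ (sum_unionCount_le y A))
        rw [Finset.sum_mul, ← smul_eq_mul]
        exact Finset.card_nsmul_le_sum _ _ _ fun x hx => (hA x hx).le
      have hj : j.1 ≤ R := by omega
      generalize j.1 = j at hmarkov hj
      obtain ⟨i, hi⟩ := Nat.exists_eq_add_of_le hj
      have hpos' : 0 < 2 ^ (j * r) * c * 2 ^ n := by positivity
      have hexp : 12 * R * r + 2 * r = (i + 2) * r + j * r + 11 * R * r := by
        have : 11 * R * r + (i + j) * r = 12 * R * r := by rw [hi]; ring
        linarith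
      refine Nat.le_of_mul_le_mul_right ?_ hpos'
      calc A.card * ((2 ^ (4 * R * r)) ^ 2 * 2 ^ r) * (2 ^ (j * r) * c * 2 ^ n)
          = (A.card * (2 ^ (j * r) * c)) * (2 ^ n * (2 ^ (4 * R * r)) ^ 2 * 2 ^ r) := by ring
        _ ≤ (unionCount w (Fin 3) ∅ y * 2 ^ (4 * R * r)) *
              (2 ^ n * (2 ^ (4 * R * r)) ^ 2 * 2 ^ r) := Nat.mul_le_mul_right _ hmarkov
        _ = (unionCount w (Fin 3) ∅ y * 2 ^ n) * ((2 ^ (4 * R * r)) ^ 3 * 2 ^ r) := by ring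
        _ ≤ (2 ^ r * c ^ 3) * ((2 ^ (4 * R * r)) ^ 3 * 2 ^ r) := Nat.mul_le_mul_right _ (h3 y)
        _ = 2 ^ (12 * R * r + 2 * r) * c ^ 3 := by
            rw [show 12 * R * r + 2 * r = r + 4 * R * r * 3 + r by ring, pow_add, pow_add,
              pow_mul _ _ 3]
            ring
        _ = 2 ^ ((R + 2 - j) * r) * c ^ 2 * (2 ^ (j * r) * c * 2 ^ n) := by
            rw [show R + 2 - j = i + 2 by omega, hexp, pow_add, pow_add]
            ring
    · refine card_large_matching_mul_two_pow_le _ _ _ hk (Q := 1) (by omega) le_rfl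
        fun f A hA => ?_
      rw [hcard, Fintype.card_fin]
      have hAc : A.card ≤ unionCount w (Fin 2) (f v).1 y :=
        Finset.card_le_card fun x hx => Finset.mem_filter.2
          ⟨Finset.mem_univ _, by simpa [codeUnion, unionOf] using hA x hx⟩
      refine (Nat.mul_le_mul_right _ hAc).trans (le_trans (le_of_eq ?_)
        ((h2 (f v).1 y (f v).2.le).trans (le_of_eq (one_mul _).symm)))
      rw [← pow_mul, ← pow_add]
      congr 2
      ring
    · refine card_large_matching_mul_two_pow_le _ _ _ hk (hN _) (Nat.le_add_right _ _)
        fun f A hA => ?_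
      rw [hcard, Fintype.card_fin, pow_one, pow_one, ← mul_assoc]
      -- The codegree bound inside the relation does not involve x, so any one member of `A`
      -- supplies it.
      rcases A.eq_empty_or_nonempty with rfl | ⟨x₀, hx₀⟩
      · simp
      have hAc : A.card ≤ unionCount w (Fin 1) (codeUnion Subtype.val f {a, b}) y :=
        Finset.card_le_card fun x hx => by simpa [unionOf] using (hA x hx).2
      refine (Nat.mul_le_mul_right _ ((Nat.mul_le_mul_right _ hAc).trans (hA x₀ hx₀).1)).trans
        (le_of_eq ?_)
      rw [mul_right_comm, ← pow_add]
      congr 2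
      ring
  obtain ⟨f, hf⟩ := exists_forall_notMem_of_card_mul_le _ _ hcount hbad
  exact ⟨f, fun i => by simpa using hf i⟩

theorem codeUnion_comp {I J α β : Type*} [DecidableEq β] (u : α → Finset β) (f : I → α)
    (φ : J ↪ I) (e : Finset J) : codeUnion u (f ∘ φ) e = codeUnion u f (e.map φ) := by
  ext b
  simp [codeUnion]

theorem NoLargeMatching.comp {I J α β : Type*} [DecidableEq β] {u : α → Finset β} {f : I → α}
    (φ : J ↪ I) {F : Finset J} {s : ℕ} {Rel : Finset β → Finset β → Prop} {N : ℕ}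
    (h : NoLargeMatching u f (F.map φ) s Rel N) : NoLargeMatching u (f ∘ φ) F s Rel N := by
  intro M hM hdisj
  have := h (M.map (Finset.mapEmbedding φ).toEmbedding) ?_ ?_
  · simpa using this
  · intro e he
    obtain ⟨e₀, he₀, rfl⟩ := Finset.mem_map.1 he
    have := hM e₀ he₀
    simp only [codeUnion_comp] at this
    exact ⟨by simpa using this.1, by simpa using this.2.1, this.2.2⟩
  · intro e he e' he' hne
    simp only [Finset.coe_map, Set.mem_image] at he he'
    obtain ⟨e, he, rfl⟩ := he
    obtain ⟨e', he', rfl⟩ := he'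
    have := hdisj he he' fun h => hne (by rw [h])
    simpa [Function.onFun] using this

theorem codeUnion_insert {I α β : Type*} [DecidableEq I] [DecidableEq β] (u : α → Finset β)
    (f : I → α) (a : I) (e : Finset I) :
    codeUnion u f (insert a e) = codeUnion u f {a} ∪ codeUnion u f e := by
  simp [codeUnion]

theorem exists_code_of_le (R : ℕ) (hR : 60 ≤ R) : ∀ᶠ r : ℕ in atTop, ∀ t ≤ 2 ^ (4 * R * r),
    ∃ w : ℕ, ∃ f : Fin t → WeightSet (11 * R * r) w, ∀ y,
    NoLargeMatching Subtype.val f ∅ 3 (fun z x => z ∪ x = y) (20 * R + 2 ^ ((R + 2) * r)) ∧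
    (∀ j ≤ R, NoLargeMatching Subtype.val f ∅ 2
      (fun _ x => 2 ^ (j * r) * (11 * R * r).choose w <
        unionCount w (Fin 1) x y * 2 ^ (4 * R * r)) (20 * R + 2 ^ ((R + 2 - j) * r))) ∧
    (∀ v, NoLargeMatching Subtype.val f {v} 2 (fun z x => z ∪ x = y) (20 * R)) ∧
    (∀ j ≤ R + 1, ∀ a b, NoLargeMatching Subtype.val f {a, b} 1
      (fun z x => unionCount w (Fin 1) z y * 2 ^ (4 * R * r) ≤
        2 ^ (j * r) * (11 * R * r).choose w ∧ z ∪ x = y) (20 * R + 2 ^ ((j + 1) * r))) ∧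
    (∀ a b, unionCount w (Fin 1) (codeUnion Subtype.val f {a, b}) y * 2 ^ (4 * R * r) ≤
      2 ^ ((R + 1) * r) * (11 * R * r).choose w) := by
  filter_upwards [exists_code R hR] with r ⟨w, f, hf⟩ t ht
  let φ : Fin t ↪ Fin (2 ^ (4 * R * r)) := Fin.castLEEmb ht
  refine ⟨w, f ∘ φ, fun y => ?_⟩
  obtain ⟨h1, h2, h3, h4, h5⟩ := hf y
  refine ⟨NoLargeMatching.comp φ (by simpa using h1),
    fun j hj => NoLargeMatching.comp φ (by simpa using h2 j hj),
    fun v => NoLargeMatching.comp φ (by simpa using h3 (φ v)),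
    fun j hj a b => NoLargeMatching.comp φ (by simpa using h4 j hj (φ a) (φ b)), fun a b => ?_⟩
  rw [codeUnion_comp]
  simpa using h5 (φ a) (φ b)

/-! ### The five-stage algorithm -/

theorem solvable_five (R : ℕ) (hR : 60 ≤ R) : ∀ᶠ r : ℕ in atTop, ∀ t ≤ 2 ^ (4 * R * r),
    Solvable 5 {S : Finset (Fin t) | S.card = 3} (11 * R * r +
      ((2 * (40 * R + 40 * R * (40 * R) + 40 * R * (40 * R)) + 1) * (R + 2) + 40 * R +
        (R + 6) * r)) := by
  classical
  have hbig : ∀ᶠ r : ℕ in atTop, 60 * R + 3 ≤ 2 ^ r := by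
    filter_upwards [eventually_ge_atTop (60 * R + 3)] with r hr
    exact hr.trans Nat.lt_two_pow_self.le
  filter_upwards [exists_code_of_le R hR, hbig] with r hcode hr t ht
  obtain ⟨w, f, hf⟩ := hcode t ht
  set c := (11 * R * r).choose w
  -- Constants and set sizes are absorbed into one extra factor 2^r.
  have hsize : ∀ a m : ℕ, m ≤ 3 → (20 * R + 2 ^ (a * r)) * m ≤ 2 ^ ((a + 1) * r) := by
    intro a m hm
    have h1 : 1 ≤ 2 ^ (a * r) := Nat.one_le_two_pow
    calc (20 * R + 2 ^ (a * r)) * m ≤ (20 * R * 2 ^ (a * r) + 2 ^ (a * r)) * 3 := by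
          refine Nat.mul_le_mul (Nat.add_le_add_right ?_ _) hm
          exact Nat.le_mul_of_pos_right _ h1
      _ = 2 ^ (a * r) * (60 * R + 3) := by ring
      _ ≤ 2 ^ (a * r) * 2 ^ r := Nat.mul_le_mul_left _ hr
      _ = _ := by rw [add_mul, one_mul, pow_add]
  refine Solvable.stage (fun i => Finset.univ.filter fun v => i ∈ (f v).1) fun o => ?_
  set y : Finset (Fin (11 * R * r)) := Finset.univ.filter fun i => o i = true with hy
  obtain ⟨h1, h2, h3, h4, h5⟩ := hf y
  let U : Finset (Fin t) → Finset (Fin (11 * R * r)) := codeUnion Subtype.val f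
  let H : Finset (Finset (Fin t)) := Finset.univ.filter fun e => e.card = 3 ∧ U e = y
  have hH : ∀ e, e ∈ H ↔ e.card = 3 ∧ U e = y := fun e => by simp [H]
  have hUins : ∀ a e, U (insert a e) = U {a} ∪ U e := codeUnion_insert _ _
  have hsub : {S ∈ {S : Finset (Fin t) | S.card = 3} | outcomeVector
      (fun i => Finset.univ.filter fun v => i ∈ (f v).1) S = o} ⊆ (H : Set (Finset (Fin t))) := by
    rintro S ⟨hS, rfl⟩
    refine (hH S).2 ⟨hS, ?_⟩
    ext i
    simp [hy, U, codeUnion, outcomeVector, Finset.Nonempty, and_comm]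
  obtain ⟨W₀, hW₀, hW₀H⟩ := exists_hittingSet H 3 (20 * R + 2 ^ ((R + 2) * r))
    (fun e he => ((hH e).1 he).1) (by norm_num) fun M hM hdisj => (h1 M (fun e he => by
      obtain ⟨he3, hey⟩ := (hH e).1 (hM he)
      exact ⟨he3, Finset.disjoint_empty_left _, (Finset.empty_union (U e)).trans hey⟩)
      hdisj).le
  have hWex : ∀ j : ℕ, ∃ W : Finset (Fin t), j ≤ R → W.card ≤ (20 * R + 2 ^ ((R + 2 - j) * r)) * 2 ∧
      ∀ e : Finset (Fin t), e.card = 2 →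
        2 ^ (j * r) * c < unionCount w (Fin 1) (U e) y * 2 ^ (4 * R * r) → ∃ v ∈ e, v ∈ W := by
    intro j
    by_cases hj : j ≤ R
    · obtain ⟨W, hW, hWH⟩ := exists_hittingSet
        (Finset.univ.filter fun e : Finset (Fin t) => e.card = 2 ∧
          2 ^ (j * r) * c < unionCount w (Fin 1) (U e) y * 2 ^ (4 * R * r)) 2
        (20 * R + 2 ^ ((R + 2 - j) * r)) (fun e he => (Finset.mem_filter.1 he).2.1) (by norm_num)
        fun M hM hdisj => (h2 j hj M (fun e he => by
          obtain ⟨-, he2, hey⟩ := Finset.mem_filter.1 (hM he)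
          exact ⟨he2, Finset.disjoint_empty_left _, hey⟩) hdisj).le
      exact ⟨W, fun _ => ⟨hW, fun e he he' => hWH e (by simp [he, he'])⟩⟩
    · exact ⟨∅, fun h => absurd h hj⟩
  choose W' hW' using hWex
  have hCov : ∀ v, ∃ C : Finset (Fin t), C.card ≤ 20 * R * 2 ∧
      ∀ e : Finset (Fin t), e.card = 2 → v ∉ e → U {v} ∪ U e = y → ∃ u ∈ e, u ∈ C := by
    intro v
    obtain ⟨C, hC, hCH⟩ := exists_hittingSet
      (Finset.univ.filter fun e : Finset (Fin t) => e.card = 2 ∧ v ∉ e ∧ U {v} ∪ U e = y) 2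
      (20 * R) (fun e he => (Finset.mem_filter.1 he).2.1) (by norm_num)
      fun M hM hdisj => (h3 v M (fun e he => by
        obtain ⟨-, he2, hve, hey⟩ := Finset.mem_filter.1 (hM he)
        exact ⟨he2, Finset.disjoint_singleton_left.2 hve, hey⟩) hdisj).le
    exact ⟨C, hC, fun e he hv hey => hCH e (by simp [he, hv, hey])⟩
  choose Cov hCovc hCov using hCov
  have hleaves : ∀ j ≤ R + 1, ∀ a b, unionCount w (Fin 1) (U {a, b}) y * 2 ^ (4 * R * r) ≤
      2 ^ (j * r) * c → (leaves H a b).card ≤ 2 ^ ((j + 2) * r) := by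
    intro j hj a b hab
    have := h4 j hj a b ((leaves H a b).map ⟨fun x => {x}, Finset.singleton_injective⟩) ?_ ?_
    · rw [Finset.card_map] at this
      have h := hsize (j + 1) 1 (by norm_num)
      rw [mul_one] at h
      exact this.le.trans h
    · intro e he
      obtain ⟨x, hx, rfl⟩ := Finset.mem_map.1 he
      obtain ⟨hxa, hxb, hxH⟩ := mem_leaves.1 hx
      refine ⟨by simp, ?_, hab, ?_⟩
      · simp [hxa, hxb]
      · rw [← ((hH _).1 hxH).2]
        show U {a, b} ∪ U {x} = U {a, b, x}
        rw [hUins a {b}, hUins a {b, x}, hUins b {x}, Finset.union_assoc]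
    · intro e he e' he' hne
      simp only [Finset.coe_map, Set.mem_image] at he he'
      obtain ⟨x, -, rfl⟩ := he
      obtain ⟨x', -, rfl⟩ := he'
      simp only [Function.onFun, Function.Embedding.coeFn_mk, id, Finset.disjoint_singleton]
      rintro rfl
      exact hne rfl
  refine Solvable.mono (Solvable.of_stratified (H := H) (fun e he => ((hH e).1 he).1) Cov (40 * R)
    (fun v => (hCovc v).trans (by omega)) ?_ (L := R + 2)
    -- Level 0 uses a hitting set of all of H; level j ≥ 1 one of the pairs of expected codegree
    -- above 2^((j-1)r). The exponents R+4-j and j+2 always sum to R+6.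
    (fun j => if j.1 = 0 then W₀ else W' (j.1 - 1))
    (fun j => (R + 4 - j.1) * r) (fun j => (j.1 + 2) * r) ((R + 6) * r) ?_ ?_ ?_ ?_)
    hsub le_rfl
  · intro e he v hv
    obtain ⟨he3, hey⟩ := (hH e).1 he
    obtain ⟨u, hu, huC⟩ := hCov v (e.erase v) (by rw [Finset.card_erase_of_mem hv, he3])
      (Finset.notMem_erase v e) (by rw [← hUins, Finset.insert_erase hv, hey])
    exact ⟨u, Finset.mem_of_mem_erase hu, Finset.ne_of_mem_erase hu, huC⟩
  · rintro ⟨j, hj⟩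
    dsimp only
    split_ifs with h
    · refine hW₀.trans ((hsize _ 3 le_rfl).trans (Nat.pow_le_pow_right (by norm_num) ?_))
      exact Nat.mul_le_mul_right _ (by omega)
    · have hj' : j - 1 ≤ R := by omega
      refine (hW' (j - 1) hj').1.trans ((hsize _ 2 (by norm_num)).trans
        (Nat.pow_le_pow_right (by norm_num) ?_))
      exact Nat.mul_le_mul_right _ (by omega)
  · intro i j hij
    have : i.1 ≤ j.1 := hij
    exact Nat.mul_le_mul_right _ (by omega)
  · rintro ⟨j, hj⟩
    dsimp only
    rw [← add_mul]
    exact Nat.mul_le_mul_right _ (by omega)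
  · intro e he
    obtain ⟨he3, hey⟩ := (hH e).1 he
    -- The level of an edge is the least j bounding the expected codegrees of its pairs; if j ≥ 1,
    -- minimality gives a pair above 2^((j-1)r), which the set of level j hits.
    let Q : ℕ → Prop := fun j => ∀ a ∈ e, ∀ b ∈ e, a ≠ b →
      unionCount w (Fin 1) (U {a, b}) y * 2 ^ (4 * R * r) ≤ 2 ^ (j * r) * c
    have hQ : ∃ j, Q j := ⟨R + 1, fun a _ b _ _ => h5 a b⟩
    have hle : Nat.find hQ ≤ R + 1 := Nat.find_min' hQ fun a _ b _ _ => h5 a b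
    refine ⟨⟨Nat.find hQ, by omega⟩, ?_, fun a ha b hb hab =>
      hleaves _ hle a b (Nat.find_spec hQ a ha b hb hab)⟩
    dsimp only
    split_ifs with h
    · exact hW₀H e he
    · have hmin := Nat.find_min hQ (m := Nat.find hQ - 1) (by omega)
      simp only [Q, not_forall, not_le] at hmin
      obtain ⟨a, ha, b, hb, hab, hlt⟩ := hmin
      obtain ⟨v, hv, hvW⟩ := (hW' (Nat.find hQ - 1) (by omega)).2 {a, b}
        (Finset.card_pair hab) hlt
      refine ⟨v, ?_, hvW⟩
      simp only [Finset.mem_insert, Finset.mem_singleton] at hv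
      rcases hv with rfl | rfl <;> assumption

/-! ### Asymptotics -/

theorem eventually_minTests_five_le (R : ℕ) (hR : 60 ≤ R) : ∃ K : ℝ, ∀ᶠ t : ℕ in atTop,
    (minTests 5 t 3 : ℝ) ≤ (3 + 3 / 2 / R) * Real.logb 2 t + K := by
  obtain ⟨r₀, hr₀⟩ := eventually_atTop.1 (solvable_five R hR)
  set q : ℕ := (2 * (40 * R + 40 * R * (40 * R) + 40 * R * (40 * R)) + 1) * (R + 2) + 40 * R
  refine ⟨12 * R + 6 + (3 + 3 / 2 / R) + q, ?_⟩
  filter_upwards [eventually_gt_atTop (2 ^ (4 * R * r₀)), eventually_ge_atTop 2] with t ht ht2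
  -- Then 4Rr exceeds ⌈log₂ t⌉ by at most 4R, a bounded loss that goes into the constant.
  set r := Nat.clog 2 t / (4 * R) + 1 with hr
  have hR0 : 0 < 4 * R := by omega
  have hclog : Nat.clog 2 t ≤ 4 * R * r := by
    have := Nat.lt_mul_div_succ (Nat.clog 2 t) hR0
    exact this.le
  have htr : t ≤ 2 ^ (4 * R * r) :=
    (Nat.le_pow_clog (by norm_num) t).trans (Nat.pow_le_pow_right (by norm_num) hclog)
  have hrr : r₀ ≤ r := by
    by_contra! h
    have : 2 ^ (4 * R * r) ≤ 2 ^ (4 * R * r₀) :=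
      Nat.pow_le_pow_right (by norm_num) (Nat.mul_le_mul_left _ h.le)
    omega
  have hmin := minTests_le_of_solvable (hr₀ r hrr t htr)
  have hmin' : (minTests 5 t 3 : ℝ) ≤ 12 * R * r + 6 * r + q := by
    have : (minTests 5 t 3 : ℝ) ≤ 11 * R * r + (q + (R + 6) * r) := by exact_mod_cast hmin
    linarith
  have hrle : (4 * R * r : ℝ) ≤ Nat.clog 2 t + 4 * R := by
    have : 4 * R * r ≤ Nat.clog 2 t + 4 * R := by
      rw [hr, mul_add, mul_one]
      exact Nat.add_le_add_right (Nat.mul_div_le _ _) _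
    exact_mod_cast this
  have hlog : (Nat.clog 2 t : ℝ) ≤ Real.logb 2 t + 1 := by
    have h1 : 2 ^ (Nat.clog 2 t - 1) < t := Nat.pow_pred_clog_lt_self (by norm_num) ht2
    have h2 : (2 : ℝ) ^ (Nat.clog 2 t - 1) ≤ t := by exact_mod_cast h1.le
    have h3 := (Real.le_logb_iff_rpow_le (b := 2) (by norm_num)
      (by positivity : (0 : ℝ) < t)).2 (by rw [Real.rpow_natCast]; exact h2)
    have h4 : 1 ≤ Nat.clog 2 t := Nat.clog_pos (by norm_num) ht2
    push_cast [h4] at h3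
    linarith
  have hRpos : (0 : ℝ) < R := by
    have : 0 < R := by omega
    exact_mod_cast this
  have h6 : (6 * r : ℝ) ≤ 3 / 2 / R * (Real.logb 2 t + 1) + 6 := by
    have : (6 * r : ℝ) = 3 / 2 / R * (4 * R * r) := by field_simp; ring
    rw [this]
    calc 3 / 2 / R * (4 * R * r : ℝ) ≤ 3 / 2 / R * (Real.logb 2 t + 1 + 4 * R) := by
          gcongr; linarith
      _ = _ := by field_simp; ring
  linarith

theorem le_minTests {p t : ℕ} (hp : 1 ≤ p) (ht : 3 ≤ t) :
    3 * Real.logb 2 t - 8 ≤ minTests p t 3 := by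
  have h1 : (t + 1 - 3) ^ 3 ≤ 6 * 2 ^ minTests p t 3 := by
    refine (Nat.pow_sub_le_descFactorial t 3).trans ?_
    rw [Nat.descFactorial_eq_factorial_mul_choose]
    exact Nat.mul_le_mul_left _ (choose_le_two_pow_minTests hp)
  have h2 : (t : ℝ) ^ 3 ≤ 2 ^ (minTests p t 3 + 8) := by
    have h3 : t ≤ 3 * (t + 1 - 3) := by omega
    have : t ^ 3 ≤ 2 ^ (minTests p t 3 + 8) := by
      calc t ^ 3 ≤ (3 * (t + 1 - 3)) ^ 3 := Nat.pow_le_pow_left h3 3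
        _ = 27 * (t + 1 - 3) ^ 3 := by ring
        _ ≤ 27 * (6 * 2 ^ minTests p t 3) := Nat.mul_le_mul_left _ h1
        -- 27 · 6 = 162 ≤ 2^8.
        _ ≤ 2 ^ (minTests p t 3 + 8) := by rw [pow_add]; omega
    exact_mod_cast this
  have ht0 : (0 : ℝ) < t := by
    have : 0 < t := by omega
    exact_mod_cast this
  have h3 := (Real.logb_le_iff_le_rpow (b := 2) (by norm_num) (by positivity)).2
    (h2.trans (Real.rpow_natCast 2 _).ge)
  rw [Real.logb_pow] at h3
  push_cast at h3
  linarith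

theorem tendsto_logb_two_natCast : Tendsto (fun t : ℕ => Real.logb 2 (t : ℝ)) atTop atTop :=
  (Real.tendsto_logb_atTop (by norm_num)).comp tendsto_natCast_atTop_atTop

theorem tendsto_sub_div_logb : Tendsto (fun t : ℕ => 3 - 8 / Real.logb 2 (t : ℝ)) atTop (𝓝 3) := by
  simpa using tendsto_const_nhds.sub (tendsto_logb_two_natCast.const_div_atTop (8 : ℝ))

theorem eventually_le_minTests_div (p : ℕ) (hp : 1 ≤ p) : ∀ᶠ t : ℕ in atTop,
    3 - 8 / Real.logb 2 (t : ℝ) ≤ minTests p t 3 / Real.logb 2 (t : ℝ) := by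
  filter_upwards [eventually_ge_atTop 3, tendsto_logb_two_natCast.eventually_gt_atTop 0]
    with t ht hlog
  rw [le_div_iff₀ hlog, sub_mul, div_mul_cancel₀ _ hlog.ne']
  exact le_minTests hp ht

theorem tendsto_minTests_five_div : Tendsto
    (fun t : ℕ => (minTests 5 t 3 : ℝ) / Real.logb 2 (t : ℝ)) atTop (𝓝 3) := by
  refine tendsto_order.2 ⟨fun a ha => ?_, fun a ha => ?_⟩
  · filter_upwards [tendsto_sub_div_logb.eventually_const_lt ha,
      eventually_le_minTests_div 5 (by norm_num)] with t h1 h2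
    exact h1.trans_le h2
  · obtain ⟨R, hR⟩ := exists_nat_gt (3 / 2 / (a - 3))
    have ha' : 0 < a - 3 := by linarith
    obtain ⟨R', hR60, hRR⟩ : ∃ R', 60 ≤ R' ∧ R ≤ R' := ⟨max 60 R, le_max_left _ _, le_max_right _ _⟩
    have hR'0 : (0 : ℝ) < R' := by
      have : 0 < R' := by omega
      exact_mod_cast this
    have hlt : 3 + 3 / 2 / (R' : ℝ) < a := by
      have h1 : 3 / 2 / (a - 3) < (R' : ℝ) := hR.trans_le (by exact_mod_cast hRR)
      rw [div_lt_iff₀ ha'] at h1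
      have : 3 / 2 / (R' : ℝ) < a - 3 := by rw [div_lt_iff₀ hR'0]; linarith
      linarith
    obtain ⟨K, hK⟩ := eventually_minTests_five_le R' hR60
    have hlim : Tendsto (fun t : ℕ => 3 + 3 / 2 / (R' : ℝ) + K / Real.logb 2 (t : ℝ)) atTop
        (𝓝 (3 + 3 / 2 / (R' : ℝ))) := by
      simpa using tendsto_const_nhds.add (tendsto_logb_two_natCast.const_div_atTop K)
    filter_upwards [hlim.eventually_lt_const hlt, hK,
      tendsto_logb_two_natCast.eventually_gt_atTop 0] with t h1 h2 hlog
    refine lt_of_le_of_lt ?_ h1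
    rw [div_le_iff₀ hlog, add_mul, div_mul_cancel₀ _ hlog.ne']
    exact h2

theorem theorem2 :
    asympConst 5 3 = 3 ∧
    (fun t : ℕ => (minTests 5 t 3 : ℝ)) ~[atTop] (fun t : ℕ => 3 * Real.logb 2 (t : ℝ)) ∧
    (∀ p : ℕ, 1 ≤ p → 3 ≤ asympConst p 3) := by
  refine ⟨?_, ?_, fun p hp => ?_⟩
  · exact ((continuous_coe_real_ereal.tendsto 3).comp tendsto_minTests_five_div).limsup_eq
  · refine isEquivalent_of_tendsto_one ?_
    have := tendsto_minTests_five_div.div_const 3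
    rw [div_self (by norm_num)] at this
    refine this.congr fun t => ?_
    simp only [Pi.div_apply]
    rw [div_div, mul_comm]
  · have hlim : Tendsto (fun t : ℕ => ((3 - 8 / Real.logb 2 (t : ℝ) : ℝ) : EReal)) atTop
        (𝓝 ((3 : ℝ) : EReal)) :=
      (continuous_coe_real_ereal.tendsto 3).comp tendsto_sub_div_logb
    have h3 : (3 : EReal) = ((3 : ℝ) : EReal) := rfl
    rw [h3, ← hlim.limsup_eq]
    refine limsup_le_limsup ?_
    filter_upwards [eventually_le_minTests_div p hp] with t h
    exact EReal.coe_le_coe_iff.2 h
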